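/- Let $q$ be a prime power and let $\mathbb{F}_q$ be the field with $q$ elements. A point-line geometry consists of points, lines and an incidence relation between points and lines; isomorphisms map points to points and lines to lines bijectively and preserve incidence in both directions. A generalized hexagon of order $(s,t)$ is a point-line geometry with non-empty point set in which every line is incident with $s+1$ points, every point is incident with $t+1$ lines, and whose incidence graph has diameter $6$ and girth $12$. A subhexagon of a point-line geometry is a set of points together with a set of lines which, with the induced incidence, forms a generalized hexagon (of some order). Let $\mathrm{H}(q,1)$ be the point-line geometry whose points are the incident point-line pairs of the Desarguesian projective plane $\mathrm{PG}(2,q)$, whose lines are the points and the lines of $\mathrm{PG}(2,q)$, and in which a pair is incident with exactly its two members. Let $\mathrm{H}(q)^D$ (the dual split Cayley hexagon) be the following point-line geometry. Put $Q(x)=x_0x_4+x_1x_5+x_2x_6-x_3^2$ for $x=(x_0,\dots,x_6)\in\mathbb{F}_q^7$. The lines of $\mathrm{H}(q)^D$ are the $1$-dimensional subspaces of $\mathbb{F}_q^7$ on which $Q$ vanishes. The points of $\mathrm{H}(q)^D$ are the $2$-dimensional subspaces of $\mathbb{F}_q^7$ on which $Q$ vanishes and whose Grassmann coordinates $p_{ij}=x_iy_j-x_jy_i$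 (where $x,y$ is a basis of the subspace) satisfy $p_{12}=p_{34}$, $p_{54}=p_{32}$, $p_{20}=p_{35}$, $p_{65}=p_{30}$, $p_{01}=p_{36}$ and $p_{46}=p_{31}$. A point and a line are incident if and only if the point, as a subspace, contains the line. Then the number of subhexagons of $\mathrm{H}(q)^D$ that are isomorphic to $\mathrm{H}(q,1)$ is exactly $$\frac{q^3(1+q)(q^2-q+1)}{2}.$$ -/

import Mathlib

namespace IncGeom

universe u v u' v'

/-- A point-line geometry: points, lines (two separate types, hence disjoint) and an incidence
relation between them. -/
structure PointLineGeometry where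
  /-- the points -/
  Point : Type u
  /-- the lines -/
  Line : Type v
  /-- the incidence relation -/
  Inc : Point → Line → Prop

namespace PointLineGeometry

/-- The incidence graph: the vertices are the points and the lines, and two vertices are adjacent
if and only if one is a point, the other is a line, and they are incident. -/
def incidenceGraph (G : PointLineGeometry.{u, v}) : SimpleGraph (G.Point ⊕ G.Line) where
  Adj a b := (∃ x l, G.Inc x l ∧ a = Sum.inl x ∧ b = Sum.inr l) ∨
    (∃ x l, G.Inc x l ∧ a = Sum.inr l ∧ b = Sum.inl x)
  symm := ⟨by
    rintro a b (⟨x, l, h, ha, hb⟩ | ⟨x, l, h, ha, hb⟩)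
    · exact Or.inr ⟨x, l, h, hb, ha⟩
    · exact Or.inl ⟨x, l, h, hb, ha⟩⟩
  loopless := ⟨by
    rintro a (⟨x, l, _, ha, hb⟩ | ⟨x, l, _, ha, hb⟩)
    · exact Sum.inl_ne_inr (ha.symm.trans hb)
    · exact Sum.inr_ne_inl (ha.symm.trans hb)⟩

/-- Generalized `n`-gon of order `(s, t)`. The diameter and the girth take values in `ℕ∞`; a
disconnected graph has diameter `⊤` and an acyclic graph has girth `⊤`. -/
structure IsGeneralizedPolygon (G : PointLineGeometry.{u, v}) (n s t : ℕ) : Prop where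
  nonempty_point : Nonempty G.Point
  card_points_on_line : ∀ l : G.Line, {x : G.Point | G.Inc x l}.ncard = s + 1
  card_lines_through_point : ∀ x : G.Point, {l : G.Line | G.Inc x l}.ncard = t + 1
  diameter : G.incidenceGraph.ediam = (n : ℕ∞)
  girth : G.incidenceGraph.egirth = ((2 * n : ℕ) : ℕ∞)

/-- An isomorphism of point-line geometries maps points to points and lines to lines, bijectively,
and preserves incidence in both directions. -/
structure Iso (G : PointLineGeometry.{u, v}) (H : PointLineGeometry.{u', v'}) where
  /-- the bijection on points -/
  onPoints : G.Point ≃ H.Point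
  /-- the bijection on lines -/
  onLines : G.Line ≃ H.Line
  inc_iff : ∀ x l, G.Inc x l ↔ H.Inc (onPoints x) (onLines l)

/-- `G` and `H` are isomorphic. -/
def IsIsomorphic (G : PointLineGeometry.{u, v}) (H : PointLineGeometry.{u', v'}) : Prop :=
  Nonempty (Iso G H)

/-- A subgeometry: a set of points and a set of lines. Its incidence is the induced one. -/
@[ext]
structure Subgeometry (G : PointLineGeometry.{u, v}) where
  /-- the points of the subgeometry -/
  points : Set G.Point
  /-- the lines of the subgeometry -/
  lines : Set G.Line

/-- A subgeometry as a point-line geometry of its own, with the induced incidence. -/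
def Subgeometry.toGeometry {G : PointLineGeometry.{u, v}} (S : Subgeometry G) :
    PointLineGeometry.{u, v} where
  Point := S.points
  Line := S.lines
  Inc x l := G.Inc x.1 l.1

/-- A subhexagon: a subgeometry that is itself a generalized hexagon, of some order. -/
def Subgeometry.IsSubhexagon {G : PointLineGeometry.{u, v}} (S : Subgeometry G) : Prop :=
  ∃ s t : ℕ, S.toGeometry.IsGeneralizedPolygon 6 s t

/-- The flag geometry of `G`: its points are the incident point-line pairs of `G`, its lines are
the points and the lines of `G`, and a pair is incident with its two members. -/
def flagGeometry (G : PointLineGeometry.{u, v}) : PointLineGeometry.{max u v, max u v} where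
  Point := {f : G.Point × G.Line // G.Inc f.1 f.2}
  Line := G.Point ⊕ G.Line
  Inc f e := e = Sum.inl f.1.1 ∨ e = Sum.inr f.1.2

end PointLineGeometry

section Hexagons

variable (F : Type u) [Field F]

/-- The Desarguesian projective plane over `F`: points and lines are the subspaces of `F ^ 3` of
dimension `1` and `2`, and incidence is containment. -/
def projectivePlane : PointLineGeometry.{u, u} where
  Point := {W : Submodule F (Fin 3 → F) // Module.finrank F W = 1}
  Line := {W : Submodule F (Fin 3 → F) // Module.finrank F W = 2}
  Inc p l := p.1 ≤ l.1

/-- The generalized hexagon `H(q, 1)`, where `F` is the field with `q` elements. -/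
def hexagonQOne : PointLineGeometry.{u, u} :=
  (projectivePlane F).flagGeometry

variable {F}

/-- The quadratic form `x₀ x₄ + x₁ x₅ + x₂ x₆ - x₃ ^ 2` on `F ^ 7`. -/
def hexForm (x : Fin 7 → F) : F :=
  x 0 * x 4 + x 1 * x 5 + x 2 * x 6 - x 3 ^ 2

/-- The Grassmann coordinate `p_ij` of the pair `x`, `y`. -/
def grassmann (x y : Fin 7 → F) (i j : Fin 7) : F :=
  x i * y j - x j * y i

/-- The six linear equations between the Grassmann coordinates of the pair `x`, `y`. -/
def GrassmannEquations (x y : Fin 7 → F) : Prop :=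
  grassmann x y 1 2 = grassmann x y 3 4 ∧
  grassmann x y 5 4 = grassmann x y 3 2 ∧
  grassmann x y 2 0 = grassmann x y 3 5 ∧
  grassmann x y 6 5 = grassmann x y 3 0 ∧
  grassmann x y 0 1 = grassmann x y 3 6 ∧
  grassmann x y 4 6 = grassmann x y 3 1

/-- `W` vanishes on the quadratic form. -/
def IsSingular (W : Submodule F (Fin 7 → F)) : Prop :=
  ∀ x ∈ W, hexForm x = 0

variable (F)

/-- The dual split Cayley hexagon `H(q)^D`, where `F` is the field with `q` elements. Its lines are
the `1`-dimensional subspaces of `F ^ 7` on which the quadratic form vanishes, its points are the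
`2`-dimensional subspaces on which the form vanishes and whose Grassmann coordinates (with respect
to any basis `x`, `y`) satisfy the six equations, and incidence is reverse containment. -/
def dualSplitCayleyHexagon : PointLineGeometry.{u, u} where
  Point := {W : Submodule F (Fin 7 → F) // Module.finrank F W = 2 ∧ IsSingular W ∧
    ∀ x y : Fin 7 → F, LinearIndependent F ![x, y] → Submodule.span F {x, y} = W →
      GrassmannEquations x y}
  Line := {W : Submodule F (Fin 7 → F) // Module.finrank F W = 1 ∧ IsSingular W}
  Inc p l := l.1 ≤ p.1

end Hexagons

end IncGeom

/-! View `F ^ 7` as the trace zero split octonions in Zorn's coordinates, with `hexForm` the norm up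
to sign. The points of the dual split Cayley hexagon are then the 2-dimensional subspaces on which
the octonion product vanishes identically (`isSingular_grassmann_iff`). Explicit linear maps that
preserve the form and the vanishing of products act transitively on hyperbolic pairs, that is, on
pairs of singular vectors whose polar value is one (`exists_isHexAut_of_hexPolar_eq_one`).

One subgeometry of the required type is visible. Coordinates 0, 1, 2 and coordinates 4, 5, 6 span
two totally singular 3-spaces which the polar form makes dual to each other. A 1-space of the first
is a point of the plane, a 1-space of the second is by duality a line of the plane, and the hexagon
points meeting both are the flags (`standardSubhexagon_isIsomorphic`).

Conversely, a subgeometry isomorphic to `hexagonQOne F` attaches singular vectors to the points and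
lines of the plane, with product zero for incident elements. Two elements of the same type have a
common neighbor, which makes their vectors orthogonal; yet not all pairs are orthogonal
(`IsPlaneRealization.exists_hexPolar_ne_zero`), so some hyperbolic pair is covered. Once that pair
is moved to `hexE₀`, `hexE₄`, the orthogonality relations force every vector into one of the two
standard 3-spaces (`IsPlaneRealization.mem_range`), and finiteness gives equality with the standard
example. Hence each hyperbolic pair is covered by exactly one such subgeometry.

Now count pairs in two ways. There are `(q^3 - 1)(q^3 + 1)q^5` hyperbolic pairs and each subgeometry
covers `2(q^3 - 1)q^2` of them, so there are `q^3(q^3 + 1)/2` subgeometries. Being a subhexagon is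
automatic, because the flag geometry of a finite projective plane is a generalized hexagon. -/

namespace IncGeom

universe u v u' v' u'' v''

open PointLineGeometry

namespace PointLineGeometry

/-! ### Transport of polygons and subgeometries along isomorphisms. -/

section Isomorphisms

variable {G : PointLineGeometry.{u, v}} {H : PointLineGeometry.{u', v'}}
  {K : PointLineGeometry.{u'', v''}}

@[simp]
theorem incidenceGraph_adj_inl_inr {x : G.Point} {l : G.Line} :
    G.incidenceGraph.Adj (Sum.inl x) (Sum.inr l) ↔ G.Inc x l := by
  simp [incidenceGraph]

@[simp]
theorem incidenceGraph_adj_inr_inl {x : G.Point} {l : G.Line} :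
    G.incidenceGraph.Adj (Sum.inr l) (Sum.inl x) ↔ G.Inc x l := by
  simp [incidenceGraph]

@[simp]
theorem not_incidenceGraph_adj_inl_inl {x y : G.Point} :
    ¬ G.incidenceGraph.Adj (Sum.inl x) (Sum.inl y) := by
  simp [incidenceGraph]

@[simp]
theorem not_incidenceGraph_adj_inr_inr {l m : G.Line} :
    ¬ G.incidenceGraph.Adj (Sum.inr l) (Sum.inr m) := by
  simp [incidenceGraph]

/-- The inverse of an isomorphism. -/
def Iso.symm (e : Iso G H) : Iso H G where
  onPoints := e.onPoints.symm
  onLines := e.onLines.symm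
  inc_iff x l := by simp [e.inc_iff]

/-- The composite of two isomorphisms. -/
def Iso.trans (e : Iso G H) (f : Iso H K) : Iso G K where
  onPoints := e.onPoints.trans f.onPoints
  onLines := e.onLines.trans f.onLines
  inc_iff x l := by simp [e.inc_iff, f.inc_iff]

/-- An isomorphism of geometries induces an isomorphism of incidence graphs. -/
def Iso.incidenceGraphIso (e : Iso G H) : G.incidenceGraph ≃g H.incidenceGraph where
  toEquiv := Equiv.sumCongr e.onPoints e.onLines
  map_rel_iff' := by
    rintro (a | a) (b | b) <;> simp [e.inc_iff]

theorem edist_iso_le {V : Type*} {W : Type*} {A : SimpleGraph V} {B : SimpleGraph W} (e : A ≃g B)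
    (a b : V) : B.edist (e a) (e b) ≤ A.edist a b := by
  refine le_iInf fun w => ?_
  have := (w.map e.toHom).edist_le
  rwa [SimpleGraph.Walk.length_map] at this

theorem ediam_le_of_iso {V : Type*} {W : Type*} {A : SimpleGraph V} {B : SimpleGraph W}
    (e : A ≃g B) : B.ediam ≤ A.ediam := by
  refine SimpleGraph.ediam_le_of_edist_le fun a b => ?_
  have := edist_iso_le e (e.symm a) (e.symm b)
  simp only [RelIso.apply_symm_apply] at this
  exact this.trans SimpleGraph.edist_le_ediam

theorem IsGeneralizedPolygon.of_iso {n s t : ℕ} (h : G.IsGeneralizedPolygon n s t) (e : Iso G H) :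
    H.IsGeneralizedPolygon n s t where
  nonempty_point := h.nonempty_point.map e.onPoints
  card_points_on_line l := by
    rw [← h.card_points_on_line (e.onLines.symm l)]
    refine (Set.ncard_congr (fun x _ => e.onPoints x) ?_ ?_ ?_).symm
    · intro x hx
      simpa [e.inc_iff] using hx
    · intro x y _ _ hxy
      exact e.onPoints.injective hxy
    · intro y hy
      exact ⟨e.onPoints.symm y, by simpa [e.inc_iff] using hy, by simp⟩
  card_lines_through_point x := by
    rw [← h.card_lines_through_point (e.onPoints.symm x)]
    refine (Set.ncard_congr (fun l _ => e.onLines l) ?_ ?_ ?_).symm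
    · intro x hx
      simpa [e.inc_iff] using hx
    · intro x y _ _ hxy
      exact e.onLines.injective hxy
    · intro y hy
      exact ⟨e.onLines.symm y, by simpa [e.inc_iff] using hy, by simp⟩
  diameter := by
    rw [← h.diameter]
    exact le_antisymm (ediam_le_of_iso e.incidenceGraphIso)
      (ediam_le_of_iso e.incidenceGraphIso.symm)
  girth := by rw [← h.girth, e.incidenceGraphIso.egirth_eq]

/-- The image of a subgeometry under an isomorphism. -/
def Subgeometry.map (e : Iso G H) (S : Subgeometry G) : Subgeometry H where
  points := e.onPoints '' S.points
  lines := e.onLines '' S.lines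

/-- A subgeometry is isomorphic to its image. -/
def Subgeometry.isoMap (e : Iso G H) (S : Subgeometry G) :
    Iso S.toGeometry (S.map e).toGeometry where
  onPoints := e.onPoints.image S.points
  onLines := e.onLines.image S.lines
  inc_iff x l := e.inc_iff x.1 l.1

theorem Subgeometry.map_symm_map (e : Iso G H) (S : Subgeometry G) : (S.map e).map e.symm = S := by
  ext x <;> simp [Subgeometry.map, Iso.symm]

end Isomorphisms

end PointLineGeometry

/-! ### The flag geometry of a finite projective plane is a generalized hexagon. -/

namespace PointLineGeometry

/-- A finite projective plane of order `q`, given by the counts and the incidence axioms. -/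
structure IsProjectivePlane (G : PointLineGeometry.{u, v}) (q : ℕ) : Prop where
  exists_line : ∀ x y : G.Point, ∃ l, G.Inc x l ∧ G.Inc y l
  exists_point : ∀ l m : G.Line, ∃ x, G.Inc x l ∧ G.Inc x m
  eq_or_eq : ∀ {x y : G.Point} {l m : G.Line}, G.Inc x l → G.Inc y l → G.Inc x m → G.Inc y m →
    x = y ∨ l = m
  exists_triangle : ∃ x y z : G.Point, ∃ l m n : G.Line, G.Inc x l ∧ G.Inc y l ∧ G.Inc y m ∧
    G.Inc z m ∧ G.Inc z n ∧ G.Inc x n ∧ ¬ G.Inc x m ∧ ¬ G.Inc y n ∧ ¬ G.Inc z l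
  card_points_on_line : ∀ l : G.Line, {x : G.Point | G.Inc x l}.ncard = q + 1
  card_lines_through_point : ∀ x : G.Point, {l : G.Line | G.Inc x l}.ncard = q + 1

section Plane

variable {G : PointLineGeometry.{u, v}} {q : ℕ}

/-- Points and lines are treated together as vertices of the incidence graph, so that the two dual
axioms become one and later arguments need no case split on the type. The type is recorded by
`isLeft`. -/
theorem IsProjectivePlane.exists_common_neighbor (h : G.IsProjectivePlane q)
    {a b : G.Point ⊕ G.Line} (hab : a.isLeft = b.isLeft) :
    ∃ c, G.incidenceGraph.Adj a c ∧ G.incidenceGraph.Adj b c := by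
  rcases a with a | a <;> rcases b with b | b <;> simp at hab
  · obtain ⟨l, h1, h2⟩ := h.exists_line a b
    exact ⟨Sum.inr l, by simpa, by simpa⟩
  · obtain ⟨l, h1, h2⟩ := h.exists_point a b
    exact ⟨Sum.inl l, by simpa, by simpa⟩

theorem isLeft_ne_of_adj {a b : G.Point ⊕ G.Line} (h : G.incidenceGraph.Adj a b) :
    a.isLeft = !b.isLeft := by
  rcases a with a | a <;> rcases b with b | b <;> simp at h ⊢

/-- This is the absence of 4-cycles in the incidence graph of the plane. -/
theorem IsProjectivePlane.eq_of_common_neighbors (h : G.IsProjectivePlane q)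
    {a b c d : G.Point ⊕ G.Line} (hab : a ≠ b) (hac : G.incidenceGraph.Adj a c)
    (hbc : G.incidenceGraph.Adj b c) (had : G.incidenceGraph.Adj a d)
    (hbd : G.incidenceGraph.Adj b d) : c = d := by
  rcases a with a | a <;> rcases c with c | c <;> simp at hac <;>
  rcases b with b | b <;> simp at hbc <;> rcases d with d | d <;> simp at had hbd
  · have := h.eq_or_eq hac hbc had hbd
    simp_all
  · have := h.eq_or_eq hac had hbc hbd
    simp_all

theorem flagGeometry_inc_fst (f : G.flagGeometry.Point) :
    G.flagGeometry.Inc f (Sum.inl f.1.1) := Or.inl rfl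

theorem flagGeometry_inc_snd (f : G.flagGeometry.Point) :
    G.flagGeometry.Inc f (Sum.inr f.1.2) := Or.inr rfl

theorem adj_of_flagGeometry_inc {f : G.flagGeometry.Point} {a b : G.Point ⊕ G.Line}
    (ha : G.flagGeometry.Inc f a) (hb : G.flagGeometry.Inc f b) (hab : a ≠ b) :
    G.incidenceGraph.Adj a b := by
  have := f.2
  rcases ha with rfl | rfl <;> rcases hb with rfl | rfl <;> simp_all

theorem exists_flag_of_adj {a b : G.Point ⊕ G.Line} (h : G.incidenceGraph.Adj a b) :
    ∃ f, G.flagGeometry.Inc f a ∧ G.flagGeometry.Inc f b := by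
  rcases a with a | a <;> rcases b with b | b <;> simp at h
  · exact ⟨⟨(a, b), h⟩, Or.inl rfl, Or.inr rfl⟩
  · exact ⟨⟨(b, a), h⟩, Or.inr rfl, Or.inl rfl⟩

theorem flagGeometry_inc_unique {f g : G.flagGeometry.Point} {a b : G.Point ⊕ G.Line}
    (hfa : G.flagGeometry.Inc f a) (hfb : G.flagGeometry.Inc f b) (hga : G.flagGeometry.Inc g a)
    (hgb : G.flagGeometry.Inc g b) (hab : a ≠ b) : f = g := by
  apply Subtype.ext
  apply Prod.ext <;>
  rcases hfa with rfl | rfl <;> rcases hfb with rfl | rfl <;> rcases hga with h1 | h1 <;>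
    rcases hgb with h2 | h2 <;> simp_all

/-- An element and an incident element of the other type are at distance at most two in the
incidence graph of the flag geometry. -/
theorem edist_flagGeometry_of_adj {a b : G.Point ⊕ G.Line} (h : G.incidenceGraph.Adj a b) :
    G.flagGeometry.incidenceGraph.edist (Sum.inr a) (Sum.inr b) ≤ 2 := by
  obtain ⟨f, ha, hb⟩ := exists_flag_of_adj h
  exact (SimpleGraph.Walk.cons (incidenceGraph_adj_inr_inl.2 ha)
    (SimpleGraph.Walk.cons (incidenceGraph_adj_inl_inr.2 hb) SimpleGraph.Walk.nil)).edist_le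

theorem edist_flagGeometry_of_inc {f : G.flagGeometry.Point} {a : G.Point ⊕ G.Line}
    (h : G.flagGeometry.Inc f a) :
    G.flagGeometry.incidenceGraph.edist (Sum.inl f) (Sum.inr a) ≤ 1 :=
  (SimpleGraph.Walk.cons (incidenceGraph_adj_inl_inr.2 h) SimpleGraph.Walk.nil).edist_le

theorem IsProjectivePlane.edist_le_four (h : G.IsProjectivePlane q) {a b : G.Point ⊕ G.Line}
    (hab : a.isLeft = b.isLeft) :
    G.flagGeometry.incidenceGraph.edist (Sum.inr a) (Sum.inr b) ≤ 4 := by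
  obtain ⟨c, hac, hbc⟩ := h.exists_common_neighbor hab
  refine (SimpleGraph.edist_triangle (v := Sum.inr c)).trans ?_
  exact (add_le_add (edist_flagGeometry_of_adj hac)
    (edist_flagGeometry_of_adj hbc.symm)).trans (by norm_num)

theorem IsProjectivePlane.exists_adj (h : G.IsProjectivePlane q) (a : G.Point ⊕ G.Line) :
    ∃ b, G.incidenceGraph.Adj a b :=
  (h.exists_common_neighbor (a := a) (b := a) rfl).imp fun _ hb => hb.1

theorem flagGeometry_exists_inc (f : G.flagGeometry.Point) (b : Bool) :
    ∃ a : G.Point ⊕ G.Line, a.isLeft = b ∧ G.flagGeometry.Inc f a := by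
  cases b
  · exact ⟨_, rfl, flagGeometry_inc_snd f⟩
  · exact ⟨_, rfl, flagGeometry_inc_fst f⟩

/-- A flag has a member of each type, and elements of equal type are at distance at most four
through a common neighbor; this gives five from a flag to an element and six between flags. For
elements of different types, one moves to a neighbor first. -/
theorem IsProjectivePlane.edist_le_six (h : G.IsProjectivePlane q)
    (a b : G.flagGeometry.Point ⊕ G.flagGeometry.Line) :
    G.flagGeometry.incidenceGraph.edist a b ≤ 6 := by
  have key : ∀ (f : G.flagGeometry.Point) (c : G.Point ⊕ G.Line),
      G.flagGeometry.incidenceGraph.edist (Sum.inl f) (Sum.inr c) ≤ 5 := by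
    intro f c
    obtain ⟨d, hd, hfd⟩ := flagGeometry_exists_inc f c.isLeft
    refine (SimpleGraph.edist_triangle (v := Sum.inr d)).trans ?_
    exact (add_le_add (edist_flagGeometry_of_inc hfd) (h.edist_le_four hd)).trans (by norm_num)
  rcases a with f | a
  · rcases b with g | b
    · refine (SimpleGraph.edist_triangle (v := Sum.inr (Sum.inl g.1.1))).trans ?_
      refine (add_le_add (key f _) ?_).trans (by norm_num : (5 : ℕ∞) + 1 ≤ 6)
      exact SimpleGraph.edist_comm.trans_le
        (edist_flagGeometry_of_inc (flagGeometry_inc_fst g))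
    · exact (key f b).trans (by norm_num)
  · rcases b with g | b
    · exact SimpleGraph.edist_comm.trans_le ((key g a).trans (by norm_num))
    · obtain ⟨c, hc⟩ := h.exists_adj a
      by_cases hab : a.isLeft = b.isLeft
      · exact (h.edist_le_four hab).trans (by norm_num)
      · have hcb : c.isLeft = b.isLeft := by
          have := isLeft_ne_of_adj hc
          revert this hab
          cases a.isLeft <;> cases b.isLeft <;> cases c.isLeft <;> simp
        refine (SimpleGraph.edist_triangle (v := Sum.inr c)).trans ?_
        exact (add_le_add (edist_flagGeometry_of_adj hc) (h.edist_le_four hcb)).trans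
          (by norm_num)

/-- A function that changes by at most one along edges bounds the length of walks. -/
theorem le_length_of_lipschitz {V : Type*} {A : SimpleGraph V} (φ : V → ℕ)
    (hφ : ∀ a b, A.Adj a b → φ b ≤ φ a + 1) {a b : V} (w : A.Walk a b) :
    φ b ≤ φ a + w.length := by
  induction w with
  | nil => simp
  | cons h p ih =>
    have := hφ _ _ h
    rw [SimpleGraph.Walk.length_cons]
    omega

open Classical in
/-- The distance from the point `x`, on the incidence graph of the flag geometry. -/
noncomputable def flagDistance (x : G.Point) : G.flagGeometry.Point ⊕ (G.Point ⊕ G.Line) → ℕ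
  | Sum.inl f => if f.1.1 = x then 1 else if G.Inc x f.1.2 then 3 else 5
  | Sum.inr (Sum.inl y) => if y = x then 0 else 4
  | Sum.inr (Sum.inr l) => if G.Inc x l then 2 else 6

/-- Only the Lipschitz property is needed to bound distances from below; that the values are the
true distances is never used. -/
theorem flagDistance_lipschitz (x : G.Point) (a b : G.flagGeometry.Point ⊕ (G.Point ⊕ G.Line))
    (hab : G.flagGeometry.incidenceGraph.Adj a b) :
    flagDistance x b ≤ flagDistance x a + 1 := by
  have key : ∀ (f : G.flagGeometry.Point) (c : G.Point ⊕ G.Line), G.flagGeometry.Inc f c →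
      flagDistance x (Sum.inr c) ≤ flagDistance x (Sum.inl f) + 1 ∧
      flagDistance x (Sum.inl f) ≤ flagDistance x (Sum.inr c) + 1 := by
    rintro f c (rfl | rfl)
    · have := f.2
      by_cases h1 : f.1.1 = x
      · simp [flagDistance, h1]
      · by_cases h2 : G.Inc x f.1.2 <;> simp [flagDistance, h1, h2]
    · have := f.2
      by_cases h1 : f.1.1 = x
      · rw [h1] at this
        simp [flagDistance, h1, this]
      · by_cases h2 : G.Inc x f.1.2 <;> simp [flagDistance, h1, h2]
  rcases a with f | a <;> rcases b with g | b
  · exact absurd hab (not_incidenceGraph_adj_inl_inl (G := G.flagGeometry))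
  · exact (key f b (incidenceGraph_adj_inl_inr.1 hab)).1
  · exact (key g a (incidenceGraph_adj_inr_inl.1 hab)).2
  · exact absurd hab (not_incidenceGraph_adj_inr_inr (G := G.flagGeometry))

/-- The value six is attained by a vertex of a triangle and the opposite side. -/
theorem IsProjectivePlane.ediam_flagGeometry (h : G.IsProjectivePlane q) :
    G.flagGeometry.incidenceGraph.ediam = 6 := by
  refine le_antisymm (SimpleGraph.ediam_le_of_edist_le h.edist_le_six) ?_
  obtain ⟨x, y, z, l, m, n, h⟩ := h.exists_triangle
  have hxm : ¬ G.Inc x m := h.2.2.2.2.2.2.1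
  refine le_trans ?_ (SimpleGraph.edist_le_ediam (u := Sum.inr (Sum.inl x))
    (v := Sum.inr (Sum.inr m)))
  refine le_iInf fun w => ?_
  have := le_length_of_lipschitz _ (flagDistance_lipschitz x) w
  simp only [flagDistance, hxm, if_true, if_false, zero_add] at this
  exact_mod_cast this

/-- A cycle of length `2k` starting at a line alternates between flags and elements of the plane,
and its elements form a closed walk of length `k` in the bipartite incidence graph of the plane.
Thus `k` is even; `k = 2` would repeat a flag, and `k = 4` would give a 4-cycle in the plane. -/
theorem IsProjectivePlane.twelve_le_length (h : G.IsProjectivePlane q) {a : G.Point ⊕ G.Line}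
    (w : G.flagGeometry.incidenceGraph.Walk (Sum.inr a) (Sum.inr a)) (hw : w.IsCycle) :
    12 ≤ w.length := by
  by_contra! hlt
  have hstep : ∀ i (b : G.Point ⊕ G.Line), i + 2 ≤ w.length → w.getVert i = Sum.inr b →
      ∃ f c, w.getVert (i + 1) = Sum.inl f ∧ w.getVert (i + 2) = Sum.inr c ∧
        G.flagGeometry.Inc f b ∧ G.flagGeometry.Inc f c := by
    intro i b hi hb
    have h1 := w.adj_getVert_succ (i := i) (by omega)
    have h2 := w.adj_getVert_succ (i := i + 1) (by omega)
    rw [hb] at h1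
    rcases h3 : w.getVert (i + 1) with f | f
    · rw [h3] at h1 h2
      rw [show i + 1 + 1 = i + 2 from rfl] at h2
      rcases h4 : w.getVert (i + 2) with c | c
      · rw [h4] at h2
        simp at h2
      · rw [h4] at h2
        exact ⟨f, c, rfl, rfl, incidenceGraph_adj_inr_inl.1 h1, incidenceGraph_adj_inl_inr.1 h2⟩
    · rw [h3] at h1
      exact absurd h1 (not_incidenceGraph_adj_inr_inr (G := G.flagGeometry))
  -- The base vertex occurs at both ends of the cycle, so index 0 is left out here and replaced by
  -- `w.length` where it matters.
  have hinj : ∀ i j, 1 ≤ i → i ≤ w.length → 1 ≤ j → j ≤ w.length →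
      w.getVert i = w.getVert j → i = j := by
    intro i j h1 h2 h3 h4 h5
    exact hw.getVert_injOn ⟨h1, h2⟩ ⟨h3, h4⟩ h5
  have hlast : w.getVert w.length = Sum.inr a := w.getVert_length
  have heven : ∀ k, 2 * k ≤ w.length → ∃ b, w.getVert (2 * k) = Sum.inr b := by
    intro k
    induction k with
    | zero => exact fun _ => ⟨a, w.getVert_zero⟩
    | succ k ih =>
      intro hk
      obtain ⟨b, hb⟩ := ih (by omega)
      obtain ⟨_, c, _, hc, _⟩ := hstep (2 * k) b (by omega) hb
      exact ⟨c, hc⟩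
  have hlen : w.length % 2 = 0 := by
    by_contra hodd
    obtain ⟨b, hb⟩ := heven (w.length / 2) (by omega)
    have h1 := w.adj_getVert_succ (i := 2 * (w.length / 2)) (by omega)
    rw [hb, show 2 * (w.length / 2) + 1 = w.length by omega, hlast] at h1
    exact absurd h1 (not_incidenceGraph_adj_inr_inr (G := G.flagGeometry))
  have hne : ∀ i b c, i + 2 ≤ w.length → w.getVert i = Sum.inr b →
      w.getVert (i + 2) = Sum.inr c → b ≠ c := by
    rintro i b c h2 h3 h4 rfl
    have h5 := hw.three_le_length
    rcases Nat.eq_zero_or_pos i with rfl | hi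
    · have := hinj (0 + 2) w.length (by omega) (by omega) (by omega) le_rfl
        (h4.trans (h3.symm.trans (w.getVert_zero.trans hlast.symm)))
      omega
    · have := hinj i (i + 2) hi (by omega) (by omega) h2 (h3.trans h4.symm)
      omega
  have hadj : ∀ i b, i + 2 ≤ w.length → w.getVert i = Sum.inr b →
      ∃ f c, w.getVert (i + 1) = Sum.inl f ∧ w.getVert (i + 2) = Sum.inr c ∧
        G.flagGeometry.Inc f b ∧ G.flagGeometry.Inc f c ∧ G.incidenceGraph.Adj b c ∧ b ≠ c := by
    intro i b hi hb
    obtain ⟨f, c, h1, h2, h3, h4⟩ := hstep i b hi hb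
    have := hne i b c hi hb h2
    exact ⟨f, c, h1, h2, h3, h4, adj_of_flagGeometry_inc h3 h4 this, this⟩
  have h3 := hw.three_le_length
  obtain ⟨f1, a2, e1, e2, i1, i2, j1, n1⟩ := hadj 0 a (by omega) w.getVert_zero
  obtain ⟨f3, a4, e3, e4, i3, i4, j3, n3⟩ := hadj 2 a2 (by omega) e2
  by_cases l4 : w.length = 4
  · have : a4 = a := by
      rw [l4] at hlast
      exact Sum.inr_injective (e4.symm.trans hlast)
    subst this
    have := flagGeometry_inc_unique i1 i2 i4 i3 n1
    subst this
    have := hinj 1 3 (by omega) (by omega) (by omega) (by omega) (e1.trans e3.symm)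
    omega
  obtain ⟨f5, a6, e5, e6, i5, i6, j5, n5⟩ := hadj 4 a4 (by omega) e4
  have t1 := isLeft_ne_of_adj j1
  have t3 := isLeft_ne_of_adj j3
  have t5 := isLeft_ne_of_adj j5
  -- Three changes of type cannot lead back to the initial element.
  by_cases l6 : w.length = 6
  · have : a6 = a := by
      rw [l6] at hlast
      exact Sum.inr_injective (e6.symm.trans hlast)
    subst this
    simp_all
  obtain ⟨f7, a8, e7, e8, i7, i8, j7, n7⟩ := hadj 6 a6 (by omega) e6
  have t7 := isLeft_ne_of_adj j7
  by_cases l8 : w.length = 8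
  · have : a8 = a := by
      rw [l8] at hlast
      exact Sum.inr_injective (e8.symm.trans hlast)
    subst this
    -- The elements `a8` and `a4` have the common neighbors `a2` and `a6`, which must therefore
    -- coincide.
    have h84 : a8 ≠ a4 := by
      rintro rfl
      have := hinj 4 8 (by omega) (by omega) (by omega) (by omega) (e4.trans e8.symm)
      omega
    have := h.eq_of_common_neighbors h84 j1 j3.symm j7.symm j5
    subst this
    have := hinj 2 6 (by omega) (by omega) (by omega) (by omega) (e2.trans e6.symm)
    omega
  obtain ⟨f9, a10, e9, e10, i9, i10, j9, n9⟩ := hadj 8 a8 (by omega) e8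
  have t9 := isLeft_ne_of_adj j9
  -- Only length 10 is left, and five changes of type are again impossible.
  have : a10 = a := by
    rw [show w.length = 10 by omega] at hlast
    exact Sum.inr_injective (e10.symm.trans hlast)
  subst this
  simp_all

/-- The data are an ordinary hexagon, whose incidence graph is a 12-cycle. -/
theorem egirth_le_twelve {H : PointLineGeometry.{u, v}} {p : Fin 6 → H.Point} {l : Fin 6 → H.Line}
    (hp : Function.Injective p) (hl : Function.Injective l) (h1 : ∀ i, H.Inc (p i) (l i))
    (h2 : ∀ i, H.Inc (p i) (l (i + 1))) : H.incidenceGraph.egirth ≤ 12 := by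
  let φ : Fin 12 → H.Point ⊕ H.Line :=
    ![Sum.inr (l 0), Sum.inl (p 0), Sum.inr (l 1), Sum.inl (p 1), Sum.inr (l 2), Sum.inl (p 2),
      Sum.inr (l 3), Sum.inl (p 3), Sum.inr (l 4), Sum.inl (p 4), Sum.inr (l 5), Sum.inl (p 5)]
  have hφ : Function.Injective φ := by
    intro i j hij
    fin_cases i <;> fin_cases j <;> simp [φ, hp.eq_iff, hl.eq_iff] at hij ⊢
  have hsucc : ∀ i : Fin 12, H.incidenceGraph.Adj (φ i) (φ (i + 1)) := by
    intro i
    have h1' := fun i => incidenceGraph_adj_inr_inl.2 (h1 i)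
    have h2' := fun i => incidenceGraph_adj_inl_inr.2 (h2 i)
    fin_cases i
    · exact h1' 0
    · exact h2' 0
    · exact h1' 1
    · exact h2' 1
    · exact h1' 2
    · exact h2' 2
    · exact h1' 3
    · exact h2' 3
    · exact h1' 4
    · exact h2' 4
    · exact h1' 5
    · exact h2' 5
  have hhom : ∀ {i j : Fin 12}, (SimpleGraph.cycleGraph 12).Adj i j →
      H.incidenceGraph.Adj (φ i) (φ j) := by
    intro i j hij
    rcases SimpleGraph.cycleGraph_adj.1 hij with h1 | h1
    · rw [show i = j + 1 by rw [← h1]; abel]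
      exact (hsucc j).symm
    · rw [show j = i + 1 by rw [← h1]; abel]
      exact hsucc i
  have hcont : (SimpleGraph.cycleGraph 12).IsContained H.incidenceGraph :=
    ⟨⟨⟨φ, hhom⟩, hφ⟩⟩
  obtain ⟨v, p, hp, hlen⟩ := (SimpleGraph.cycleGraph_isContained_iff (by norm_num)).1 hcont
  have := SimpleGraph.egirth_le_length hp
  rw [hlen] at this
  exact_mod_cast this

theorem IsProjectivePlane.egirth_flagGeometry (h : G.IsProjectivePlane q) :
    G.flagGeometry.incidenceGraph.egirth = 12 := by
  refine le_antisymm ?_ (SimpleGraph.le_egirth.2 fun a w hw => ?_)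
  · obtain ⟨x, y, z, l, m, n, hxl, hyl, hym, hzm, hzn, hxn, hxm, hyn, hzl⟩ := h.exists_triangle
    have hxy : x ≠ y := by rintro rfl; exact hxm hym
    have hyz : y ≠ z := by rintro rfl; exact hzl hyl
    have hxz : x ≠ z := by rintro rfl; exact hxm hzm
    have hlm : l ≠ m := by rintro rfl; exact hxm hxl
    have hmn : m ≠ n := by rintro rfl; exact hxm hxn
    have hln : l ≠ n := by rintro rfl; exact hyn hyl
    -- The six flags of a triangle form an ordinary hexagon.
    refine egirth_le_twelve (H := G.flagGeometry)
      (p := ![⟨(x, l), hxl⟩, ⟨(y, l), hyl⟩, ⟨(y, m), hym⟩, ⟨(z, m), hzm⟩, ⟨(z, n), hzn⟩,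
        ⟨(x, n), hxn⟩])
      (l := ![Sum.inl x, Sum.inr l, Sum.inl y, Sum.inr m, Sum.inl z, Sum.inr n]) ?_ ?_ ?_ ?_
    · intro i j hij
      have hij1 := congrArg (fun f : G.flagGeometry.Point => f.1) hij
      clear hij
      fin_cases i <;> fin_cases j <;> simp_all [eq_comm]
    · intro i j hij
      have hij1 : (_ : G.Point ⊕ G.Line) = _ := hij
      clear hij
      fin_cases i <;> fin_cases j <;> simp_all [eq_comm]
    · intro i
      fin_cases i
      all_goals first
        | exact Or.inl rfl
        | exact Or.inr rfl
    · intro i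
      fin_cases i
      all_goals first
        | exact Or.inl rfl
        | exact Or.inr rfl
  · have key : 12 ≤ w.length := by
      rcases a with f | a
      · classical
        have h3 := hw.three_le_length
        have h1 := w.adj_getVert_succ (i := 0) (by omega)
        rw [w.getVert_zero] at h1
        rcases h2 : w.getVert (0 + 1) with g | b
        · rw [h2] at h1
          exact absurd h1 (not_incidenceGraph_adj_inl_inl (G := G.flagGeometry))
        · have hb : Sum.inr b ∈ w.support := h2 ▸ w.getVert_mem_support _
          have := h.twelve_le_length _ (hw.rotate hb)
          rwa [SimpleGraph.Walk.length_rotate] at this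
      · exact h.twelve_le_length w hw
    exact ENat.natCast_le_natCast.2 key

theorem IsProjectivePlane.isGeneralizedPolygon_flagGeometry (h : G.IsProjectivePlane q) :
    G.flagGeometry.IsGeneralizedPolygon 6 q 1 where
  nonempty_point := by
    obtain ⟨x, y, z, l, m, n, hxl, _⟩ := h.exists_triangle
    exact ⟨⟨(x, l), hxl⟩⟩
  card_points_on_line := by
    rintro (x | l)
    · rw [← h.card_lines_through_point x]
      refine Set.ncard_congr (fun f _ => f.1.2) ?_ ?_ ?_
      · rintro f (hf | hf)
        · have := f.2
          rwa [← Sum.inl_injective hf] at this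
        · simp at hf
      · rintro f g (hf | hf) (hg | hg) hfg <;> simp at hf hg
        exact Subtype.ext (Prod.ext (hf.symm.trans hg) hfg)
      · intro l hl
        exact ⟨⟨(x, l), hl⟩, Or.inl rfl, rfl⟩
    · rw [← h.card_points_on_line l]
      refine Set.ncard_congr (fun f _ => f.1.1) ?_ ?_ ?_
      · rintro f (hf | hf)
        · simp at hf
        · have := f.2
          rwa [← Sum.inr_injective hf] at this
      · rintro f g (hf | hf) (hg | hg) hfg <;> simp at hf hg
        exact Subtype.ext (Prod.ext hfg (hf.symm.trans hg))
      · intro x hx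
        exact ⟨⟨(x, l), hx⟩, Or.inr rfl, rfl⟩
  card_lines_through_point f := by
    exact Set.ncard_pair (α := G.Point ⊕ G.Line) (a := Sum.inl f.1.1) (b := Sum.inr f.1.2)
      (by simp)
  diameter := h.ediam_flagGeometry
  girth := h.egirth_flagGeometry

end Plane

end PointLineGeometry

/-! ### The Desarguesian plane satisfies the axioms, with orthogonality as duality. -/

section ProjectivePlane

variable {F : Type u} [Field F]

/-- The orthogonal complement with respect to the dot product. -/
def perp (U : Submodule F (Fin 3 → F)) : Submodule F (Fin 3 → F) :=
  LinearMap.BilinForm.orthogonal (dotProductBilin F F) U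

theorem mem_perp {U : Submodule F (Fin 3 → F)} {x : Fin 3 → F} :
    x ∈ perp U ↔ ∀ y ∈ U, y ⬝ᵥ x = 0 := Iff.rfl

theorem dotProductBilin_isRefl :
    LinearMap.BilinForm.IsRefl (dotProductBilin F F : LinearMap.BilinForm F (Fin 3 → F)) :=
  fun x y (h : x ⬝ᵥ y = 0) => (dotProduct_comm y x).trans h

theorem dotProductBilin_nondegenerate :
    (dotProductBilin F F : LinearMap.BilinForm F (Fin 3 → F)).Nondegenerate := by
  constructor
  · intro x hx
    exact dotProduct_eq_zero _ hx
  · intro x hx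
    refine dotProduct_eq_zero _ fun y => ?_
    rw [dotProduct_comm]
    exact hx y

theorem finrank_perp (U : Submodule F (Fin 3 → F)) :
    Module.finrank F (perp U) = 3 - Module.finrank F U := by
  rw [perp, LinearMap.BilinForm.finrank_orthogonal dotProductBilin_nondegenerate]
  simp

theorem perp_perp (U : Submodule F (Fin 3 → F)) : perp (perp U) = U :=
  LinearMap.BilinForm.orthogonal_orthogonal dotProductBilin_nondegenerate dotProductBilin_isRefl U

theorem perp_le_perp {U W : Submodule F (Fin 3 → F)} (h : U ≤ W) : perp W ≤ perp U :=
  LinearMap.BilinForm.orthogonal_le h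

/-- The number of one-dimensional subspaces of a plane. -/
theorem ncard_finrank_one_le [Finite F] {V : Type*} [AddCommGroup V] [Module F V]
    (L : Submodule F V) (hL : Module.finrank F L = 2) :
    {W : {W : Submodule F V // Module.finrank F W = 1} | W.1 ≤ L}.ncard = Nat.card F + 1 := by
  rw [← Projectivization.card_of_finrank_two F L hL,
    Nat.card_congr (Projectivization.equivSubmodule F L), ← Nat.card_coe_set_eq]
  refine Nat.card_congr ⟨fun W => ⟨W.1.1.comap L.subtype, ?_⟩,
    fun W => ⟨⟨W.1.map L.subtype, ?_⟩, Submodule.map_subtype_le _ _⟩, ?_, ?_⟩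
  · have := W.1.2
    rwa [← (Submodule.comapSubtypeEquivOfLe W.2).finrank_eq] at this
  · have := W.2
    rwa [Submodule.finrank_map_subtype_eq]
  · intro W
    apply Subtype.ext
    apply Subtype.ext
    exact (Submodule.map_comap_subtype _ _).trans (inf_eq_right.2 W.2)
  · intro W
    apply Subtype.ext
    exact Submodule.comap_map_eq_of_injective L.subtype_injective _

theorem exists_finrank_one_le {V : Type*} [AddCommGroup V] [Module F V] {L : Submodule F V}
    (hL : L ≠ ⊥) : ∃ W : Submodule F V, Module.finrank F W = 1 ∧ W ≤ L := by
  obtain ⟨x, hx, h0⟩ := Submodule.exists_mem_ne_zero_of_ne_bot hL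
  exact ⟨F ∙ x, finrank_span_singleton h0, by simpa using hx⟩

theorem projectivePlane_exists_point (l m : (projectivePlane F).Line) :
    ∃ x, (projectivePlane F).Inc x l ∧ (projectivePlane F).Inc x m := by
  have h1 := Submodule.finrank_sup_add_finrank_inf_eq l.1 m.1
  have h2 := Submodule.finrank_le (l.1 ⊔ m.1)
  rw [l.2, m.2] at h1
  rw [Module.finrank_fin_fun] at h2
  obtain ⟨W, hW, hle⟩ := exists_finrank_one_le (L := l.1 ⊓ m.1) (by
    intro h
    rw [h, finrank_bot] at h1
    omega)
  exact ⟨⟨W, hW⟩, hle.trans inf_le_left, hle.trans inf_le_right⟩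

theorem eq_sup_of_finrank {V : Type*} [AddCommGroup V] [Module F V] [FiniteDimensional F V]
    {x y l : Submodule F V} (hx : Module.finrank F x = 1)
    (hy : Module.finrank F y = 1) (hl : Module.finrank F l = 2) (hxy : x ≠ y) (hxl : x ≤ l)
    (hyl : y ≤ l) : x ⊔ y = l := by
  refine Submodule.eq_of_le_of_finrank_le (sup_le hxl hyl) ?_
  rw [hl]
  by_contra! h
  have h1 : x = x ⊔ y := Submodule.eq_of_le_of_finrank_le le_sup_left (by omega)
  have h2 : y = x ⊔ y := Submodule.eq_of_le_of_finrank_le le_sup_right (by omega)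
  exact hxy (h1.trans h2.symm)

theorem isProjectivePlane_projectivePlane [Finite F] :
    (projectivePlane F).IsProjectivePlane (Nat.card F) where
  exists_line x y := by
    -- The line joining `x` and `y` is the complement of a common point of their complements.
    obtain ⟨z, h1, h2⟩ := projectivePlane_exists_point (F := F)
      ⟨perp x.1, by rw [finrank_perp, x.2]⟩ ⟨perp y.1, by rw [finrank_perp, y.2]⟩
    refine ⟨⟨perp z.1, by rw [finrank_perp, z.2]⟩, ?_, ?_⟩
    · have := perp_le_perp h1
      rwa [perp_perp] at this
    · have := perp_le_perp h2
      rwa [perp_perp] at this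
  exists_point := projectivePlane_exists_point
  eq_or_eq := by
    intro x y l m h1 h2 h3 h4
    by_cases hxy : x = y
    · exact Or.inl hxy
    · have hxy' : x.1 ≠ y.1 := fun h => hxy (Subtype.ext h)
      refine Or.inr (Subtype.ext ?_)
      rw [← eq_sup_of_finrank x.2 y.2 l.2 hxy' h1 h2, ← eq_sup_of_finrank x.2 y.2 m.2 hxy' h3 h4]
  exists_triangle := by
    let e : Fin 3 → (Fin 3 → F) := fun i => Pi.single i 1
    have hp : ∀ i, Module.finrank F (F ∙ e i) = 1 := fun i => finrank_span_singleton (by simp [e])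
    have hl : ∀ i, Module.finrank F (perp (F ∙ e i)) = 2 := fun i => by rw [finrank_perp, hp]
    have key : ∀ i j, F ∙ e i ≤ perp (F ∙ e j) ↔ j ≠ i := by
      intro i j
      simp only [Submodule.span_singleton_le_iff_mem, mem_perp, Submodule.mem_span_singleton]
      constructor
      · intro h hij
        have := h (e j) ⟨1, by simp⟩
        rw [hij] at this
        simp [e] at this
      · rintro hij y ⟨a, rfl⟩
        simp [e, hij]
    -- The coordinate triangle: the side orthogonal to `e j` contains the other two vertices and
    -- misses `e j`.
    refine ⟨⟨_, hp 0⟩, ⟨_, hp 1⟩, ⟨_, hp 2⟩, ⟨_, hl 2⟩, ⟨_, hl 0⟩, ⟨_, hl 1⟩, ?_⟩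
    simp [projectivePlane, key]
  card_points_on_line l := ncard_finrank_one_le l.1 l.2
  card_lines_through_point x := by
    have hx : Module.finrank F (perp x.1) = 2 := by rw [finrank_perp, x.2]
    rw [← ncard_finrank_one_le (perp x.1) hx]
    refine Set.ncard_congr (fun l _ => ⟨perp l.1, by rw [finrank_perp, l.2]⟩) ?_ ?_ ?_
    · intro l hl
      exact perp_le_perp hl
    · intro l m _ _ h
      apply Subtype.ext
      rw [← perp_perp l.1, ← perp_perp m.1]
      exact congrArg (fun W => perp W.1) h
    · intro W hW
      refine ⟨⟨perp W.1, by rw [finrank_perp, W.2]⟩, ?_, Subtype.ext (perp_perp _)⟩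
      have := perp_le_perp hW
      rwa [perp_perp] at this

theorem isGeneralizedPolygon_hexagonQOne [Finite F] :
    (hexagonQOne F).IsGeneralizedPolygon 6 (Nat.card F) 1 :=
  isProjectivePlane_projectivePlane.isGeneralizedPolygon_flagGeometry

end ProjectivePlane

/-! ### Vanishing octonion products and the Grassmann equations. -/

section Zorn

variable {F : Type u} [Field F]

/-- The polar form of the quadratic form `hexForm`. -/
def hexPolar (x y : Fin 7 → F) : F :=
  x 0 * y 4 + x 4 * y 0 + x 1 * y 5 + x 5 * y 1 + x 2 * y 6 + x 6 * y 2 - 2 * (x 3 * y 3)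

/-- The vanishing of the product of two trace zero split octonions, in the coordinates of Zorn's
vector matrices. -/
def ZornOrthogonal (x y : Fin 7 → F) : Prop :=
  (x 1 * y 2 - x 2 * y 1 = x 3 * y 4 - x 4 * y 3 ∧
  x 2 * y 0 - x 0 * y 2 = x 3 * y 5 - x 5 * y 3 ∧
  x 0 * y 1 - x 1 * y 0 = x 3 * y 6 - x 6 * y 3) ∧
  (x 5 * y 6 - x 6 * y 5 = x 0 * y 3 - x 3 * y 0 ∧
  x 6 * y 4 - x 4 * y 6 = x 1 * y 3 - x 3 * y 1 ∧
  x 4 * y 5 - x 5 * y 4 = x 2 * y 3 - x 3 * y 2) ∧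
  x 0 * y 4 + x 1 * y 5 + x 2 * y 6 = x 3 * y 3 ∧
  x 4 * y 0 + x 5 * y 1 + x 6 * y 2 = x 3 * y 3

theorem ZornOrthogonal.symm {x y : Fin 7 → F} (h : ZornOrthogonal x y) : ZornOrthogonal y x := by
  obtain ⟨⟨h1, h2, h3⟩, ⟨h4, h5, h6⟩, h7, h8⟩ := h
  refine ⟨⟨?_, ?_, ?_⟩, ⟨?_, ?_, ?_⟩, ?_, ?_⟩
  · linear_combination -h1
  · linear_combination -h2
  · linear_combination -h3
  · linear_combination -h4
  · linear_combination -h5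
  · linear_combination -h6
  · linear_combination h8
  · linear_combination h7

theorem ZornOrthogonal.add_right {x y z : Fin 7 → F} (hy : ZornOrthogonal x y)
    (hz : ZornOrthogonal x z) : ZornOrthogonal x (y + z) := by
  obtain ⟨⟨h1, h2, h3⟩, ⟨h4, h5, h6⟩, h7, h8⟩ := hy
  obtain ⟨⟨k1, k2, k3⟩, ⟨k4, k5, k6⟩, k7, k8⟩ := hz
  refine ⟨⟨?_, ?_, ?_⟩, ⟨?_, ?_, ?_⟩, ?_, ?_⟩ <;> simp only [Pi.add_apply]
  · linear_combination h1 + k1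
  · linear_combination h2 + k2
  · linear_combination h3 + k3
  · linear_combination h4 + k4
  · linear_combination h5 + k5
  · linear_combination h6 + k6
  · linear_combination h7 + k7
  · linear_combination h8 + k8

theorem ZornOrthogonal.smul_right {x y : Fin 7 → F} (c : F) (h : ZornOrthogonal x y) :
    ZornOrthogonal x (c • y) := by
  obtain ⟨⟨h1, h2, h3⟩, ⟨h4, h5, h6⟩, h7, h8⟩ := h
  refine ⟨⟨?_, ?_, ?_⟩, ⟨?_, ?_, ?_⟩, ?_, ?_⟩ <;> simp only [Pi.smul_apply, smul_eq_mul]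
  · linear_combination c * h1
  · linear_combination c * h2
  · linear_combination c * h3
  · linear_combination c * h4
  · linear_combination c * h5
  · linear_combination c * h6
  · linear_combination c * h7
  · linear_combination c * h8

theorem ZornOrthogonal.of_smul_right {x y : Fin 7 → F} {c : F} (hc : c ≠ 0)
    (h : ZornOrthogonal x (c • y)) : ZornOrthogonal x y := by
  have := h.smul_right c⁻¹
  rwa [inv_smul_smul₀ hc] at this

/-- The square of a trace zero octonion is a scalar, equal to the form up to sign. -/
theorem zornOrthogonal_self {x : Fin 7 → F} : ZornOrthogonal x x ↔ hexForm x = 0 := by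
  constructor
  · rintro ⟨-, -, h, -⟩
    unfold hexForm
    linear_combination h
  · intro h
    unfold hexForm at h
    refine ⟨⟨?_, ?_, ?_⟩, ⟨?_, ?_, ?_⟩, ?_, ?_⟩
    iterate 6 ring
    · linear_combination h
    · linear_combination h

theorem ZornOrthogonal.hexPolar_eq_zero {x y : Fin 7 → F} (h : ZornOrthogonal x y) :
    hexPolar x y = 0 := by
  obtain ⟨-, -, h7, h8⟩ := h
  unfold hexPolar
  linear_combination h7 + h8

theorem ZornOrthogonal.grassmannEquations {x y : Fin 7 → F} (h : ZornOrthogonal x y) :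
    GrassmannEquations x y := by
  obtain ⟨⟨h1, h2, h3⟩, ⟨h4, h5, h6⟩, h7, h8⟩ := h
  unfold GrassmannEquations grassmann
  refine ⟨?_, ?_, ?_, ?_, ?_, ?_⟩
  · linear_combination h1
  · linear_combination -h6
  · linear_combination h2
  · linear_combination -h4
  · linear_combination h3
  · linear_combination -h5

theorem hexForm_add {x y : Fin 7 → F} :
    hexForm (x + y) = hexForm x + hexForm y + hexPolar x y := by
  simp only [hexForm, hexPolar, Pi.add_apply]
  ring

/-- The Grassmann equations are the six vector components of the product; what remains are two
scalar components, of which the polar form controls only the sum. The first is shown to vanish after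
multiplication by `x 3` and by `y 3`. If both of these coordinates are zero, its square vanishes by
the identity `(a × c) · (b × d) = (a · b)(c · d) - (a · d)(b · c)`. No division by two occurs, so
characteristic two is included. -/
theorem zornOrthogonal_of_grassmannEquations {x y : Fin 7 → F} (hx : hexForm x = 0)
    (hy : hexForm y = 0) (hxy : hexPolar x y = 0) (h : GrassmannEquations x y) :
    ZornOrthogonal x y := by
  simp only [GrassmannEquations, grassmann] at h
  obtain ⟨h1, h2, h3, h4, h5, h6⟩ := h
  unfold hexForm at hx hy
  unfold hexPolar at hxy
  have key : x 0 * y 4 + x 1 * y 5 + x 2 * y 6 = x 3 * y 3 := by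
    have e1 : x 3 * (x 0 * y 4 + x 1 * y 5 + x 2 * y 6 - x 3 * y 3) = 0 := by
      linear_combination (-x 0) * h1 - x 1 * h3 - x 2 * h5 + y 3 * hx
    have e2 : y 3 * (x 0 * y 4 + x 1 * y 5 + x 2 * y 6 - x 3 * y 3) = 0 := by
      linear_combination y 3 * hxy - y 0 * h1 - y 1 * h3 - y 2 * h5 - x 3 * hy
    by_cases hx3 : x 3 = 0
    · by_cases hy3 : y 3 = 0
      · simp only [hx3, hy3] at *
        have h8 : (x 0 * y 4 + x 1 * y 5 + x 2 * y 6) ^ 2 = 0 := by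
          linear_combination (x 0 * y 4 + x 1 * y 5 + x 2 * y 6) * hxy +
            (x 5 * y 6 - x 6 * y 5) * h1 + (x 6 * y 4 - x 4 * y 6) * h3 +
            (x 4 * y 5 - x 5 * y 4) * h5 - (y 0 * y 4 + y 1 * y 5 + y 2 * y 6) * hx
        simpa using h8
      · have := (mul_eq_zero.1 e2).resolve_left hy3
        linear_combination this
    · have := (mul_eq_zero.1 e1).resolve_left hx3
      linear_combination this
  refine ⟨⟨?_, ?_, ?_⟩, ⟨?_, ?_, ?_⟩, key, ?_⟩
  · linear_combination h1
  · linear_combination h3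
  · linear_combination h5
  · linear_combination -h4
  · linear_combination -h6
  · linear_combination -h2
  · linear_combination hxy - key

/-! ### Explicit automorphisms: shift, swap, torus and root elements. -/

/-- A linear automorphism of `F ^ 7` preserving the quadratic form and `ZornOrthogonal`. -/
structure IsHexAut (g : (Fin 7 → F) ≃ₗ[F] (Fin 7 → F)) : Prop where
  hexForm_apply : ∀ x, hexForm (g x) = hexForm x
  zornOrthogonal_iff : ∀ x y, ZornOrthogonal (g x) (g y) ↔ ZornOrthogonal x y

theorem IsHexAut.trans {g h : (Fin 7 → F) ≃ₗ[F] (Fin 7 → F)} (hg : IsHexAut g) (hh : IsHexAut h) :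
    IsHexAut (g.trans h) where
  hexForm_apply x := (hh.hexForm_apply _).trans (hg.hexForm_apply _)
  zornOrthogonal_iff x y := (hh.zornOrthogonal_iff _ _).trans (hg.zornOrthogonal_iff _ _)

theorem IsHexAut.symm {g : (Fin 7 → F) ≃ₗ[F] (Fin 7 → F)} (hg : IsHexAut g) :
    IsHexAut g.symm where
  hexForm_apply x := by rw [← hg.hexForm_apply, g.apply_symm_apply]
  zornOrthogonal_iff x y := by
    rw [← hg.zornOrthogonal_iff, g.apply_symm_apply, g.apply_symm_apply]

theorem IsHexAut.hexPolar_apply {g : (Fin 7 → F) ≃ₗ[F] (Fin 7 → F)} (hg : IsHexAut g)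
    (x y : Fin 7 → F) : hexPolar (g x) (g y) = hexPolar x y := by
  have h1 := hexForm_add (x := g x) (y := g y)
  rw [← map_add, hg.hexForm_apply, hg.hexForm_apply, hg.hexForm_apply, hexForm_add] at h1
  linear_combination -h1

/-- A pair of mutually inverse linear maps given in coordinates that preserve the form and
`ZornOrthogonal` defines an automorphism. -/
theorem exists_isHexAut (f f' : (Fin 7 → F) → (Fin 7 → F))
    (hadd : ∀ x y, f (x + y) = f x + f y) (hsmul : ∀ (c : F) x, f (c • x) = c • f x)
    (h1 : ∀ x, f' (f x) = x) (h2 : ∀ x, f (f' x) = x) (hQ : ∀ x, hexForm (f x) = hexForm x)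
    (hZ : ∀ x y, ZornOrthogonal x y → ZornOrthogonal (f x) (f y))
    (hZ' : ∀ x y, ZornOrthogonal x y → ZornOrthogonal (f' x) (f' y)) :
    ∃ g : (Fin 7 → F) ≃ₗ[F] (Fin 7 → F), IsHexAut g ∧ ∀ x, g x = f x :=
  ⟨⟨⟨⟨f, hadd⟩, hsmul⟩, f', h1, h2⟩, ⟨hQ, fun x y => ⟨fun h => by
    have := hZ' _ _ h
    rwa [LinearEquiv.coe_mk, LinearMap.coe_mk, AddHom.coe_mk, h1, h1] at this, hZ x y⟩⟩,
    fun _ => rfl⟩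

/-- The coordinate form of a one-parameter family of linear maps. -/
theorem exists_isHexAut_family (f : F → (Fin 7 → F) → (Fin 7 → F))
    (hadd : ∀ t x y, f t (x + y) = f t x + f t y) (hsmul : ∀ t (c : F) x, f t (c • x) = c • f t x)
    (h1 : ∀ t x, f (-t) (f t x) = x) (hQ : ∀ t x, hexForm (f t x) = hexForm x)
    (hZ : ∀ t x y, ZornOrthogonal x y → ZornOrthogonal (f t x) (f t y)) (t : F) :
    ∃ g : (Fin 7 → F) ≃ₗ[F] (Fin 7 → F), IsHexAut g ∧ ∀ x, g x = f t x :=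
  exists_isHexAut (f t) (f (-t)) (hadd t) (hsmul t) (h1 t)
    (fun x => by simpa using h1 (-t) x) (hQ t) (hZ t) (hZ (-t))

/-- The cyclic shift of the coordinates. -/
theorem exists_isHexAut_cycle : ∃ g : (Fin 7 → F) ≃ₗ[F] (Fin 7 → F), IsHexAut g ∧
    ∀ x, g x = ![x 1, x 2, x 0, x 3, x 5, x 6, x 4] := by
  refine exists_isHexAut _ (fun x => ![x 2, x 0, x 1, x 3, x 6, x 4, x 5]) ?_ ?_ ?_ ?_ ?_ ?_ ?_
  · intro x y; ext i; fin_cases i <;> rfl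
  · intro c x; ext i; fin_cases i <;> rfl
  · intro x; ext i; fin_cases i <;> rfl
  · intro x; ext i; fin_cases i <;> rfl
  · intro x; simp [hexForm]; ring
  · rintro x y ⟨⟨h1, h2, h3⟩, ⟨h4, h5, h6⟩, h7, h8⟩
    refine ⟨⟨h2, h3, h1⟩, ⟨h5, h6, h4⟩, ?_, ?_⟩ <;> simp
    · linear_combination h7
    · linear_combination h8
  · rintro x y ⟨⟨h1, h2, h3⟩, ⟨h4, h5, h6⟩, h7, h8⟩
    refine ⟨⟨h3, h1, h2⟩, ⟨h6, h4, h5⟩, ?_, ?_⟩ <;> simp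
    · linear_combination h7
    · linear_combination h8

/-- The automorphism that interchanges the two isotropic summands. -/
theorem exists_isHexAut_swap : ∃ g : (Fin 7 → F) ≃ₗ[F] (Fin 7 → F), IsHexAut g ∧
    ∀ x, g x = ![x 4, x 5, x 6, -x 3, x 0, x 1, x 2] := by
  have hZ : ∀ x y : Fin 7 → F, ZornOrthogonal x y →
      ZornOrthogonal ![x 4, x 5, x 6, -x 3, x 0, x 1, x 2] ![y 4, y 5, y 6, -y 3, y 0, y 1, y 2] := by
    rintro x y ⟨⟨h1, h2, h3⟩, ⟨h4, h5, h6⟩, h7, h8⟩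
    refine ⟨⟨?_, ?_, ?_⟩, ⟨?_, ?_, ?_⟩, ?_, ?_⟩ <;> simp
    · linear_combination h4
    · linear_combination h5
    · linear_combination h6
    · linear_combination h1
    · linear_combination h2
    · linear_combination h3
    · linear_combination h8
    · linear_combination h7
  refine exists_isHexAut _ _ ?_ ?_ ?_ ?_ ?_ hZ hZ
  · intro x y; ext i; fin_cases i <;> simp; ring
  · intro c x; ext i; fin_cases i <;> simp
  · intro x; ext i; fin_cases i <;> simp
  · intro x; ext i; fin_cases i <;> simp
  · intro x; simp [hexForm]; ring

/-- A torus element. -/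
theorem exists_isHexAut_torus {s : F} (hs : s ≠ 0) :
    ∃ g : (Fin 7 → F) ≃ₗ[F] (Fin 7 → F), IsHexAut g ∧
    ∀ x, g x = ![s * x 0, s⁻¹ * x 1, x 2, x 3, s⁻¹ * x 4, s * x 5, x 6] := by
  have hZ : ∀ s : F, s ≠ 0 → ∀ x y : Fin 7 → F, ZornOrthogonal x y → ZornOrthogonal
      ![s * x 0, s⁻¹ * x 1, x 2, x 3, s⁻¹ * x 4, s * x 5, x 6]
      ![s * y 0, s⁻¹ * y 1, y 2, y 3, s⁻¹ * y 4, s * y 5, y 6] := by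
    rintro s hs x y ⟨⟨h1, h2, h3⟩, ⟨h4, h5, h6⟩, h7, h8⟩
    have hs' : s * s⁻¹ = 1 := mul_inv_cancel₀ hs
    refine ⟨⟨?_, ?_, ?_⟩, ⟨?_, ?_, ?_⟩, ?_, ?_⟩ <;> simp
    · linear_combination s⁻¹ * h1
    · linear_combination s * h2
    · linear_combination h3 + (x 0 * y 1 - x 1 * y 0) * hs'
    · linear_combination s * h4
    · linear_combination s⁻¹ * h5
    · linear_combination h6 + (x 4 * y 5 - x 5 * y 4) * hs'
    · linear_combination h7 + (x 0 * y 4 + x 1 * y 5) * hs'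
    · linear_combination h8 + (x 4 * y 0 + x 5 * y 1) * hs'
  refine exists_isHexAut _
    (fun x => ![s⁻¹ * x 0, s⁻¹⁻¹ * x 1, x 2, x 3, s⁻¹⁻¹ * x 4, s⁻¹ * x 5, x 6])
    ?_ ?_ ?_ ?_ ?_ (hZ s hs) (hZ s⁻¹ (inv_ne_zero hs))
  · intro x y; ext i; fin_cases i <;> simp <;> ring
  · intro c x; ext i; fin_cases i <;> simp <;> ring
  · intro x; ext i; fin_cases i <;> simp [hs]
  · intro x; ext i; fin_cases i <;> simp [hs]
  · intro x
    have hs' : s * s⁻¹ = 1 := mul_inv_cancel₀ hs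
    simp [hexForm]
    linear_combination (x 0 * x 4 + x 1 * x 5) * hs'

/-- A long root element. -/
theorem exists_isHexAut_long_one (t : F) : ∃ g : (Fin 7 → F) ≃ₗ[F] (Fin 7 → F), IsHexAut g ∧
    ∀ x, g x = ![x 0, x 1 + t * x 0, x 2, x 3, x 4 - t * x 5, x 5, x 6] := by
  refine exists_isHexAut_family
    (fun t x => ![x 0, x 1 + t * x 0, x 2, x 3, x 4 - t * x 5, x 5, x 6]) ?_ ?_ ?_ ?_ ?_ t
  · intro t x y; ext i; fin_cases i <;> simp <;> ring
  · intro t c x; ext i; fin_cases i <;> simp <;> ring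
  · intro t x; ext i; fin_cases i <;> simp
  · intro t x; simp [hexForm]; ring
  · rintro t x y ⟨⟨h1, h2, h3⟩, ⟨h4, h5, h6⟩, h7, h8⟩
    refine ⟨⟨?_, ?_, ?_⟩, ⟨?_, ?_, ?_⟩, ?_, ?_⟩ <;> simp <;> grind

/-- A long root element. -/
theorem exists_isHexAut_long_two (t : F) : ∃ g : (Fin 7 → F) ≃ₗ[F] (Fin 7 → F), IsHexAut g ∧
    ∀ x, g x = ![x 0, x 1, x 2 + t * x 0, x 3, x 4 - t * x 6, x 5, x 6] := by
  refine exists_isHexAut_family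
    (fun t x => ![x 0, x 1, x 2 + t * x 0, x 3, x 4 - t * x 6, x 5, x 6]) ?_ ?_ ?_ ?_ ?_ t
  · intro t x y; ext i; fin_cases i <;> simp <;> ring
  · intro t c x; ext i; fin_cases i <;> simp <;> ring
  · intro t x; ext i; fin_cases i <;> simp
  · intro t x; simp [hexForm]; ring
  · rintro t x y ⟨⟨h1, h2, h3⟩, ⟨h4, h5, h6⟩, h7, h8⟩
    refine ⟨⟨?_, ?_, ?_⟩, ⟨?_, ?_, ?_⟩, ?_, ?_⟩ <;> simp <;> grind

/-- A short root element. -/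
theorem exists_isHexAut_short (t : F) : ∃ g : (Fin 7 → F) ≃ₗ[F] (Fin 7 → F), IsHexAut g ∧
    ∀ x, g x = ![x 0 + 2 * t * x 3 + t ^ 2 * x 4, x 1, x 2, x 3 + t * x 4, x 4, x 5 - t * x 2,
      x 6 + t * x 1] := by
  refine exists_isHexAut_family
    (fun t x => ![x 0 + 2 * t * x 3 + t ^ 2 * x 4, x 1, x 2, x 3 + t * x 4, x 4, x 5 - t * x 2,
      x 6 + t * x 1]) ?_ ?_ ?_ ?_ ?_ t
  · intro t x y; ext i; fin_cases i <;> simp <;> ring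
  · intro t c x; ext i; fin_cases i <;> simp <;> ring
  · intro t x; ext i; fin_cases i <;> simp <;> ring
  · intro t x; simp [hexForm]; ring
  · rintro t x y ⟨⟨h1, h2, h3⟩, ⟨h4, h5, h6⟩, h7, h8⟩
    refine ⟨⟨?_, ?_, ?_⟩, ⟨?_, ?_, ?_⟩, ?_, ?_⟩ <;> simp <;> grind

end Zorn

/-! ### Transitivity on singular vectors and on hyperbolic pairs. -/

section Transitivity

variable {F : Type u} [Field F]

/-- Conjugation by the shift and the swap yields the other root elements without repeating the
verification of the product relations. -/
theorem IsHexAut.exists_conj {g h : (Fin 7 → F) ≃ₗ[F] (Fin 7 → F)} (hg : IsHexAut g)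
    (hh : IsHexAut h) (f : (Fin 7 → F) → (Fin 7 → F)) (hf : ∀ x, h (g x) = g (f x)) :
    ∃ k : (Fin 7 → F) ≃ₗ[F] (Fin 7 → F), IsHexAut k ∧ ∀ x, k x = f x :=
  ⟨g.trans (h.trans g.symm), hg.trans (hh.trans hg.symm),
    fun x => g.symm_apply_eq.2 (hf x)⟩

/-- A short root element. -/
theorem exists_isHexAut_short_one (t : F) : ∃ g : (Fin 7 → F) ≃ₗ[F] (Fin 7 → F), IsHexAut g ∧
    ∀ x, g x = ![x 0, x 1 + 2 * t * x 3 + t ^ 2 * x 5, x 2, x 3 + t * x 5, x 4 + t * x 2, x 5,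
      x 6 - t * x 0] := by
  obtain ⟨g, hg, hgx⟩ := exists_isHexAut_cycle (F := F)
  obtain ⟨h, hh, hhx⟩ := exists_isHexAut_short t
  refine hg.exists_conj hh _ fun x => ?_
  simp [hgx, hhx]

/-- A short root element. -/
theorem exists_isHexAut_short_two (t : F) : ∃ g : (Fin 7 → F) ≃ₗ[F] (Fin 7 → F), IsHexAut g ∧
    ∀ x, g x = ![x 0, x 1, x 2 + 2 * t * x 3 + t ^ 2 * x 6, x 3 + t * x 6, x 4 - t * x 1,
      x 5 + t * x 0, x 6] := by
  obtain ⟨g, hg, hgx⟩ := exists_isHexAut_cycle (F := F)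
  obtain ⟨h, hh, hhx⟩ := exists_isHexAut_short_one t
  refine hg.exists_conj hh _ fun x => ?_
  simp [hgx, hhx]

/-- A short root element. -/
theorem exists_isHexAut_short_four (t : F) : ∃ g : (Fin 7 → F) ≃ₗ[F] (Fin 7 → F), IsHexAut g ∧
    ∀ x, g x = ![x 0, x 1 - t * x 6, x 2 + t * x 5, x 3 - t * x 0,
      x 4 - 2 * t * x 3 + t ^ 2 * x 0, x 5, x 6] := by
  obtain ⟨g, hg, hgx⟩ := exists_isHexAut_swap (F := F)
  obtain ⟨h, hh, hhx⟩ := exists_isHexAut_short t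
  refine hg.exists_conj hh _ fun x => ?_
  simp [hgx, hhx]
  constructor <;> ring

/-- The first coordinate vector. -/
def hexE₀ : Fin 7 → F := ![1, 0, 0, 0, 0, 0, 0]

/-- The coordinate vector opposite to the first. -/
def hexE₄ : Fin 7 → F := ![0, 0, 0, 0, 1, 0, 0]

/-- The singular vectors not orthogonal to `hexE₄` form one orbit, up to scalars, under its
stabilizer. -/
theorem exists_isHexAut_apply_eq_hexE₀ {x : Fin 7 → F} (hx : hexForm x = 0) (hx0 : x 0 = 1) :
    ∃ g : (Fin 7 → F) ≃ₗ[F] (Fin 7 → F), IsHexAut g ∧ g x = hexE₀ ∧ g hexE₄ = hexE₄ := by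
  have step : ∀ (h : (Fin 7 → F) ≃ₗ[F] (Fin 7 → F)) (x : Fin 7 → F), IsHexAut h →
      h hexE₄ = hexE₄ →
      (∃ g : (Fin 7 → F) ≃ₗ[F] (Fin 7 → F), IsHexAut g ∧ g (h x) = hexE₀ ∧ g hexE₄ = hexE₄) →
      ∃ g : (Fin 7 → F) ≃ₗ[F] (Fin 7 → F), IsHexAut g ∧ g x = hexE₀ ∧ g hexE₄ = hexE₄ := by
    rintro h x hh h4 ⟨g, hg, hgx, hg4⟩
    exact ⟨h.trans g, hh.trans hg, hgx, by simp [h4, hg4]⟩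
  -- With `x 0 = 1` as pivot, root elements fixing `hexE₄` clear coordinates 5, 6, 3, 1, 2 in this
  -- order, none disturbing those already cleared. Coordinate 4 then vanishes because the vector is
  -- singular.
  obtain ⟨h, hh, hhx⟩ := exists_isHexAut_short_two (-(x 5))
  refine step h x hh (by rw [hhx]; ext i; fin_cases i <;> simp [hexE₄]) ?_
  rw [← hh.hexForm_apply] at hx
  have hy0 : h x 0 = 1 := by rw [hhx]; simpa
  have hy5 : h x 5 = 0 := by rw [hhx]; simp [hx0]
  generalize h x = y at *
  clear hhx hh hx0 x h
  obtain ⟨h, hh, hhx⟩ := exists_isHexAut_short_one (y 6)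
  refine step h y hh (by rw [hhx]; ext i; fin_cases i <;> simp [hexE₄]) ?_
  rw [← hh.hexForm_apply] at hx
  have hx0 : h y 0 = 1 := by rw [hhx]; simpa
  have hx5 : h y 5 = 0 := by rw [hhx]; simpa
  have hx6 : h y 6 = 0 := by rw [hhx]; simp [hy0]
  generalize h y = x at *
  clear hhx hh hy0 hy5 y h
  obtain ⟨h, hh, hhx⟩ := exists_isHexAut_short_four (x 3)
  refine step h x hh (by rw [hhx]; ext i; fin_cases i <;> simp [hexE₄]) ?_
  rw [← hh.hexForm_apply] at hx
  have hy0 : h x 0 = 1 := by rw [hhx]; simpa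
  have hy3 : h x 3 = 0 := by rw [hhx]; simp [hx0]
  have hy5 : h x 5 = 0 := by rw [hhx]; simpa
  have hy6 : h x 6 = 0 := by rw [hhx]; simpa
  generalize h x = y at *
  clear hhx hh hx0 hx5 hx6 x h
  obtain ⟨h, hh, hhx⟩ := exists_isHexAut_long_one (-(y 1))
  refine step h y hh (by rw [hhx]; ext i; fin_cases i <;> simp [hexE₄]) ?_
  rw [← hh.hexForm_apply] at hx
  have hx0 : h y 0 = 1 := by rw [hhx]; simpa
  have hx1 : h y 1 = 0 := by rw [hhx]; simp [hy0]
  have hx3 : h y 3 = 0 := by rw [hhx]; simpa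
  have hx5 : h y 5 = 0 := by rw [hhx]; simpa
  have hx6 : h y 6 = 0 := by rw [hhx]; simpa
  generalize h y = x at *
  clear hhx hh hy0 hy3 hy5 hy6 y h
  obtain ⟨h, hh, hhx⟩ := exists_isHexAut_long_two (-(x 2))
  refine ⟨h, hh, ?_, by rw [hhx]; ext i; fin_cases i <;> simp [hexE₄]⟩
  have hx4 : x 4 = 0 := by
    unfold hexForm at hx
    simpa [hx0, hx1, hx3, hx5, hx6] using hx
  rw [hhx]
  ext i
  fin_cases i <;> simp [hexE₀, hx0, hx1, hx3, hx4, hx5, hx6]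

/-- The automorphisms act transitively on the nonzero singular vectors. -/
theorem exists_isHexAut_of_ne_zero {x : Fin 7 → F} (hx : hexForm x = 0) (h0 : x ≠ 0) :
    ∃ g : (Fin 7 → F) ≃ₗ[F] (Fin 7 → F), IsHexAut g ∧ g x = hexE₀ := by
  have step : ∀ (h : (Fin 7 → F) ≃ₗ[F] (Fin 7 → F)) (x : Fin 7 → F), IsHexAut h →
      (∃ g : (Fin 7 → F) ≃ₗ[F] (Fin 7 → F), IsHexAut g ∧ g (h x) = hexE₀) →
      ∃ g : (Fin 7 → F) ≃ₗ[F] (Fin 7 → F), IsHexAut g ∧ g x = hexE₀ := by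
    rintro h x hh ⟨g, hg, hgx⟩
    exact ⟨h.trans g, hh.trans hg, hgx⟩
  have k0 : ∀ x : Fin 7 → F, hexForm x = 0 → x 0 ≠ 0 →
      ∃ g : (Fin 7 → F) ≃ₗ[F] (Fin 7 → F), IsHexAut g ∧ g x = hexE₀ := by
    intro x hx hx0
    obtain ⟨h, hh, hhx⟩ := exists_isHexAut_torus (inv_ne_zero hx0)
    refine step h x hh ?_
    obtain ⟨g, hg, hgx, -⟩ := exists_isHexAut_apply_eq_hexE₀
      ((hh.hexForm_apply x).trans hx) (by rw [hhx]; simp [hx0])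
    exact ⟨g, hg, hgx⟩
  obtain ⟨c, hc, hcx⟩ := exists_isHexAut_cycle (F := F)
  obtain ⟨w, hw, hwx⟩ := exists_isHexAut_swap (F := F)
  have k1 : ∀ x : Fin 7 → F, hexForm x = 0 → x 1 ≠ 0 →
      ∃ g : (Fin 7 → F) ≃ₗ[F] (Fin 7 → F), IsHexAut g ∧ g x = hexE₀ :=
    fun x hx h1 => step c x hc (k0 _ ((hc.hexForm_apply x).trans hx) (by simpa [hcx]))
  have k2 : ∀ x : Fin 7 → F, hexForm x = 0 → x 2 ≠ 0 →
      ∃ g : (Fin 7 → F) ≃ₗ[F] (Fin 7 → F), IsHexAut g ∧ g x = hexE₀ :=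
    fun x hx h1 => step c x hc (k1 _ ((hc.hexForm_apply x).trans hx) (by simpa [hcx]))
  -- Shift and swap carry any nonzero coordinate other than the third to position 0. If those six
  -- all vanish, singularity kills the third as well.
  by_contra hno
  have a0 : x 0 = 0 := by_contra fun h => hno (k0 x hx h)
  have a1 : x 1 = 0 := by_contra fun h => hno (k1 x hx h)
  have a2 : x 2 = 0 := by_contra fun h => hno (k2 x hx h)
  have hx' := (hw.hexForm_apply x).trans hx
  have a4 : x 4 = 0 := by_contra fun h => hno (step w x hw (k0 _ hx' (by simpa [hwx])))
  have a5 : x 5 = 0 := by_contra fun h => hno (step w x hw (k1 _ hx' (by simpa [hwx])))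
  have a6 : x 6 = 0 := by_contra fun h => hno (step w x hw (k2 _ hx' (by simpa [hwx])))
  have a3 : x 3 = 0 := by
    unfold hexForm at hx
    simpa [a0, a1, a2, a4, a5, a6] using hx
  exact h0 (by ext i; fin_cases i <;> simpa)

/-- The automorphisms act transitively on the hyperbolic pairs of singular vectors. -/
theorem exists_isHexAut_of_hexPolar_eq_one {x y : Fin 7 → F} (hx : hexForm x = 0)
    (hy : hexForm y = 0) (hxy : hexPolar x y = 1) :
    ∃ g : (Fin 7 → F) ≃ₗ[F] (Fin 7 → F), IsHexAut g ∧ g x = hexE₀ ∧ g y = hexE₄ := by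
  have h0 : x ≠ 0 := by
    rintro rfl
    simp [hexPolar] at hxy
  obtain ⟨g, hg, hgx⟩ := exists_isHexAut_of_ne_zero hx h0
  obtain ⟨w, hw, hwx⟩ := exists_isHexAut_swap (F := F)
  have w0 : w hexE₀ = hexE₄ := by rw [hwx]; ext i; fin_cases i <;> simp [hexE₀, hexE₄]
  have w4 : w hexE₄ = hexE₀ := by rw [hwx]; ext i; fin_cases i <;> simp [hexE₀, hexE₄]
  have hgy : g y 4 = 1 := by
    rw [← hg.hexPolar_apply, hgx] at hxy
    simpa [hexPolar, hexE₀] using hxy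
  -- The swap puts the image of `x` at `hexE₄`, so the stabilizer of `hexE₄` can be used to
  -- normalize the image of `y`; a second swap restores the roles.
  obtain ⟨h, hh, h1, h2⟩ := exists_isHexAut_apply_eq_hexE₀ (x := w (g y))
    (by rw [hw.hexForm_apply, hg.hexForm_apply, hy]) (by rw [hwx]; simpa)
  refine ⟨g.trans (w.trans (h.trans w)), hg.trans (hw.trans (hh.trans hw)), ?_, ?_⟩
  · simp [hgx, w0, h2, w4]
  · simp [h1, w0]

end Transitivity

/-! ### The standard subgeometry and its isomorphism with the flag geometry of the plane. -/

section StandardSubhexagon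

variable {F : Type u} [Field F]

/-- This replaces the condition on bases by one on arbitrary pairs, which automorphisms visibly
preserve. A dependent pair consists of multiples of one singular vector, whose square is zero. -/
theorem isSingular_grassmann_iff {W : Submodule F (Fin 7 → F)} (hW : Module.finrank F W = 2) :
    (IsSingular W ∧ ∀ x y : Fin 7 → F, LinearIndependent F ![x, y] → Submodule.span F {x, y} = W →
      GrassmannEquations x y) ↔ ∀ x ∈ W, ∀ y ∈ W, ZornOrthogonal x y := by
  constructor
  · rintro ⟨hs, hg⟩ x hx y hy
    have hQx := hs x hx
    have hQy := hs y hy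
    have hxy : hexPolar x y = 0 := by
      have := hs _ (W.add_mem hx hy)
      rw [hexForm_add, hQx, hQy] at this
      simpa using this
    by_cases hli : LinearIndependent F ![x, y]
    · refine zornOrthogonal_of_grassmannEquations hQx hQy hxy (hg x y hli ?_)
      have h2 := finrank_span_eq_card hli
      rw [Matrix.range_cons_cons_empty] at h2
      refine Submodule.eq_of_le_of_finrank_eq ?_ ?_
      · rw [Submodule.span_le]
        rintro z (rfl | rfl) <;> assumption
      · rw [h2, hW]
        simp
    · by_cases h0 : x = 0
      · subst h0
        refine ZornOrthogonal.symm ?_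
        have := (zornOrthogonal_self.2 hQy).smul_right 0
        rwa [zero_smul] at this
      · rw [LinearIndependent.pair_iff' h0] at hli
        push Not at hli
        obtain ⟨a, rfl⟩ := hli
        exact (zornOrthogonal_self.2 hQx).smul_right a
  · intro h
    refine ⟨fun x hx => zornOrthogonal_self.1 (h x hx x hx), fun x y _ hW => ?_⟩
    subst hW
    exact (h _ (Submodule.subset_span (by simp)) _
      (Submodule.subset_span (by simp))).grassmannEquations

/-- A point of the dual split Cayley hexagon, given by mutually orthogonal vectors. -/
def mkHexPoint (W : Submodule F (Fin 7 → F)) (hW : Module.finrank F W = 2)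
    (h : ∀ x ∈ W, ∀ y ∈ W, ZornOrthogonal x y) : (dualSplitCayleyHexagon F).Point :=
  ⟨W, hW, (isSingular_grassmann_iff hW).2 h⟩

theorem zornOrthogonal_of_mem (p : (dualSplitCayleyHexagon F).Point) {x y : Fin 7 → F}
    (hx : x ∈ p.1) (hy : y ∈ p.1) : ZornOrthogonal x y :=
  (isSingular_grassmann_iff p.2.1).1 p.2.2 x hx y hy

/-- The line of the dual split Cayley hexagon spanned by a singular vector. -/
def mkHexLine (x : Fin 7 → F) (h0 : x ≠ 0) (hx : hexForm x = 0) :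
    (dualSplitCayleyHexagon F).Line :=
  ⟨F ∙ x, finrank_span_singleton h0, fun y hy => by
    obtain ⟨c, rfl⟩ := Submodule.mem_span_singleton.1 hy
    exact zornOrthogonal_self.1 (((zornOrthogonal_self.2 hx).smul_right c).symm.smul_right c)⟩

theorem exists_span_of_finrank_one {V : Type*} [AddCommGroup V] [Module F V] {W : Submodule F V}
    (hW : Module.finrank F W = 1) : ∃ x : V, x ≠ 0 ∧ W = F ∙ x := by
  obtain ⟨⟨x, hx⟩, h0, h⟩ := finrank_eq_one_iff'.1 hW
  refine ⟨x, fun h => h0 (Subtype.ext h), le_antisymm ?_ (by simpa using hx)⟩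
  intro y hy
  obtain ⟨c, hc⟩ := h ⟨y, hy⟩
  exact Submodule.mem_span_singleton.2 ⟨c, congrArg Subtype.val hc⟩

theorem exists_eq_mkHexLine (l : (dualSplitCayleyHexagon F).Line) :
    ∃ x h0 hx, l = mkHexLine x h0 hx := by
  obtain ⟨x, h0, hx⟩ := exists_span_of_finrank_one l.2.1
  exact ⟨x, h0, l.2.2 x (hx ▸ Submodule.mem_span_singleton_self x), Subtype.ext hx⟩

/-- The automorphism of the dual split Cayley hexagon defined by a linear automorphism. -/
def hexIso (g : (Fin 7 → F) ≃ₗ[F] (Fin 7 → F)) (hg : IsHexAut g) :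
    Iso (dualSplitCayleyHexagon F) (dualSplitCayleyHexagon F) :=
  have hp : ∀ (g : (Fin 7 → F) ≃ₗ[F] (Fin 7 → F)), IsHexAut g →
      ∀ p : (dualSplitCayleyHexagon F).Point, ∀ x ∈ p.1.map (g : (Fin 7 → F) →ₗ[F] (Fin 7 → F)),
        ∀ y ∈ p.1.map (g : (Fin 7 → F) →ₗ[F] (Fin 7 → F)), ZornOrthogonal x y := by
    rintro g hg p _ ⟨x, hx, rfl⟩ _ ⟨y, hy, rfl⟩
    exact (hg.zornOrthogonal_iff x y).2 (zornOrthogonal_of_mem p hx hy)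
  have hl : ∀ (g : (Fin 7 → F) ≃ₗ[F] (Fin 7 → F)), IsHexAut g →
      ∀ l : (dualSplitCayleyHexagon F).Line,
        IsSingular (l.1.map (g : (Fin 7 → F) →ₗ[F] (Fin 7 → F))) := by
    rintro g hg l _ ⟨x, hx, rfl⟩
    exact (hg.hexForm_apply x).trans (l.2.2 x hx)
  have hinv : ∀ W : Submodule F (Fin 7 → F),
      (W.map (g : (Fin 7 → F) →ₗ[F] (Fin 7 → F))).map (g.symm : (Fin 7 → F) →ₗ[F] (Fin 7 → F)) =
        W := by
    intro W
    rw [← Submodule.map_comp]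
    simp
  have hinv' : ∀ W : Submodule F (Fin 7 → F),
      (W.map (g.symm : (Fin 7 → F) →ₗ[F] (Fin 7 → F))).map (g : (Fin 7 → F) →ₗ[F] (Fin 7 → F)) =
        W := by
    intro W
    rw [← Submodule.map_comp]
    simp
  { onPoints :=
    { toFun := fun p => mkHexPoint (p.1.map (g : (Fin 7 → F) →ₗ[F] (Fin 7 → F)))
        ((g.finrank_map_eq p.1).trans p.2.1) (hp g hg p)
      invFun := fun p => mkHexPoint (p.1.map (g.symm : (Fin 7 → F) →ₗ[F] (Fin 7 → F)))
        ((g.symm.finrank_map_eq p.1).trans p.2.1) (hp g.symm hg.symm p)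
      left_inv := fun p => Subtype.ext (hinv p.1)
      right_inv := fun p => Subtype.ext (hinv' p.1) }
    onLines :=
    { toFun := fun l => ⟨l.1.map (g : (Fin 7 → F) →ₗ[F] (Fin 7 → F)),
        (g.finrank_map_eq l.1).trans l.2.1, hl g hg l⟩
      invFun := fun l => ⟨l.1.map (g.symm : (Fin 7 → F) →ₗ[F] (Fin 7 → F)),
        (g.symm.finrank_map_eq l.1).trans l.2.1, hl g.symm hg.symm l⟩
      left_inv := fun l => Subtype.ext (hinv l.1)
      right_inv := fun l => Subtype.ext (hinv' l.1) }
    inc_iff := fun _ _ => (Submodule.map_le_map_iff_of_injective g.injective _ _).symm }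

/-- The embedding of `F ^ 3` onto the first isotropic summand. -/
def embA : (Fin 3 → F) →ₗ[F] (Fin 7 → F) where
  toFun a := ![a 0, a 1, a 2, 0, 0, 0, 0]
  map_add' x y := by ext i; fin_cases i <;> simp
  map_smul' c x := by ext i; fin_cases i <;> simp

/-- The embedding of `F ^ 3` onto the second isotropic summand. -/
def embB : (Fin 3 → F) →ₗ[F] (Fin 7 → F) where
  toFun b := ![0, 0, 0, 0, b 0, b 1, b 2]
  map_add' x y := by ext i; fin_cases i <;> simp
  map_smul' c x := by ext i; fin_cases i <;> simp

theorem embA_apply (a : Fin 3 → F) : embA a = ![a 0, a 1, a 2, 0, 0, 0, 0] := rfl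

theorem embB_apply (b : Fin 3 → F) : embB b = ![0, 0, 0, 0, b 0, b 1, b 2] := rfl

theorem embA_add_embB_inj {a b a' b' : Fin 3 → F} (h : embA a + embB b = embA a' + embB b') :
    a = a' ∧ b = b' := by
  have h' := fun i => congrFun h i
  have h0 := h' 0
  have h1 := h' 1
  have h2 := h' 2
  have h4 := h' 4
  have h5 := h' 5
  have h6 := h' 6
  simp [embA_apply, embB_apply] at h0 h1 h2 h4 h5 h6
  constructor <;> ext i <;> fin_cases i <;> assumption

theorem embA_injective : Function.Injective (embA : (Fin 3 → F) →ₗ[F] (Fin 7 → F)) :=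
  fun a a' h => (embA_add_embB_inj (b := 0) (b' := 0) (by rw [h])).1

theorem embB_injective : Function.Injective (embB : (Fin 3 → F) →ₗ[F] (Fin 7 → F)) :=
  fun b b' h => (embA_add_embB_inj (a := 0) (a' := 0) (by rw [h])).2

theorem mem_range_embA {x : Fin 7 → F} :
    x ∈ LinearMap.range (embA : (Fin 3 → F) →ₗ[F] (Fin 7 → F)) ↔
      x 3 = 0 ∧ x 4 = 0 ∧ x 5 = 0 ∧ x 6 = 0 := by
  constructor
  · rintro ⟨a, rfl⟩
    simp [embA_apply]
  · rintro ⟨h3, h4, h5, h6⟩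
    exact ⟨![x 0, x 1, x 2], by ext i; fin_cases i <;> simp [embA_apply, *]⟩

theorem mem_range_embB {x : Fin 7 → F} :
    x ∈ LinearMap.range (embB : (Fin 3 → F) →ₗ[F] (Fin 7 → F)) ↔
      x 0 = 0 ∧ x 1 = 0 ∧ x 2 = 0 ∧ x 3 = 0 := by
  constructor
  · rintro ⟨a, rfl⟩
    simp [embB_apply]
  · rintro ⟨h3, h4, h5, h6⟩
    exact ⟨![x 4, x 5, x 6], by ext i; fin_cases i <;> simp [embB_apply, *]⟩

theorem hexForm_embA (a : Fin 3 → F) : hexForm (embA a) = 0 := by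
  simp [hexForm, embA_apply]

theorem hexForm_embB (a : Fin 3 → F) : hexForm (embB a) = 0 := by
  simp [hexForm, embB_apply]

/-- Between the two summands, vanishing of the product reduces to the dot product. This is why
incidence with a line of the plane is encoded by `perp` in the second summand. -/
theorem zornOrthogonal_embA_embB {a b : Fin 3 → F} :
    ZornOrthogonal (embA a) (embB b) ↔ a ⬝ᵥ b = 0 := by
  simp [ZornOrthogonal, embA_apply, embB_apply, dotProduct, Fin.sum_univ_three]

/-- The standard subhexagon: its lines are the singular points in the union of two disjoint planes,
its points are the hexagon points that meet both planes. -/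
def standardSubhexagon : Subgeometry (dualSplitCayleyHexagon F) where
  points := {p | p.1 ⊓ LinearMap.range (embA : (Fin 3 → F) →ₗ[F] (Fin 7 → F)) ≠ ⊥ ∧
    p.1 ⊓ LinearMap.range (embB : (Fin 3 → F) →ₗ[F] (Fin 7 → F)) ≠ ⊥}
  lines := {l | l.1 ≤ LinearMap.range (embA : (Fin 3 → F) →ₗ[F] (Fin 7 → F)) ∨
    l.1 ≤ LinearMap.range (embB : (Fin 3 → F) →ₗ[F] (Fin 7 → F))}

theorem comap_embA_sup (p r : Submodule F (Fin 3 → F)) :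
    (p.map embA ⊔ r.map embB).comap embA = p := by
  ext a
  simp only [Submodule.mem_comap, Submodule.mem_sup, Submodule.mem_map]
  constructor
  · rintro ⟨_, ⟨a', ha', rfl⟩, _, ⟨b', hb', rfl⟩, h⟩
    have := (embA_add_embB_inj (h.trans (by simp : embA a = embA a + embB 0))).1
    rwa [← this]
  · intro ha
    exact ⟨_, ⟨a, ha, rfl⟩, 0, ⟨0, r.zero_mem, by simp⟩, by simp⟩

theorem comap_embB_sup (p r : Submodule F (Fin 3 → F)) :
    (p.map embA ⊔ r.map embB).comap embB = r := by
  ext a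
  simp only [Submodule.mem_comap, Submodule.mem_sup, Submodule.mem_map]
  constructor
  · rintro ⟨_, ⟨a', ha', rfl⟩, _, ⟨b', hb', rfl⟩, h⟩
    have := (embA_add_embB_inj (h.trans (by simp : embB a = embA 0 + embB a))).2
    rwa [← this]
  · intro ha
    exact ⟨0, ⟨0, p.zero_mem, by simp⟩, _, ⟨a, ha, rfl⟩, by simp⟩

theorem map_embA_ne_map_embB {p r : Submodule F (Fin 3 → F)} (hp : Module.finrank F p = 1) :
    ¬ p.map embA ≤ r.map embB := by
  intro h
  have h1 := Submodule.map_le_iff_le_comap.1 (h.trans (le_sup_right (a := (⊥ : Submodule F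
    (Fin 3 → F)).map embA)))
  rw [comap_embA_sup, le_bot_iff] at h1
  rw [h1, finrank_bot] at hp
  omega

theorem finrank_map_of_injective {V W : Type*} [AddCommGroup V] [Module F V] [AddCommGroup W]
    [Module F W] {f : V →ₗ[F] W} (hf : Function.Injective f) (p : Submodule F V) :
    Module.finrank F (p.map f) = Module.finrank F p :=
  (Submodule.equivMapOfInjective f hf p).finrank_eq.symm

/-- The line of the standard subhexagon attached to a point or line of the projective plane. -/
def standardLine : (hexagonQOne F).Line → (standardSubhexagon (F := F)).toGeometry.Line
  | Sum.inl p => ⟨⟨p.1.map embA, (finrank_map_of_injective embA_injective _).trans p.2,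
      by rintro _ ⟨a, _, rfl⟩; exact hexForm_embA a⟩, Or.inl (LinearMap.map_le_range)⟩
  | Sum.inr l => ⟨⟨(perp l.1).map embB,
      (finrank_map_of_injective embB_injective _).trans
        (by rw [finrank_perp, l.2]),
      by rintro _ ⟨a, _, rfl⟩; exact hexForm_embB a⟩, Or.inr (LinearMap.map_le_range)⟩

theorem disjoint_range_embA_range_embB :
    Disjoint (LinearMap.range (embA : (Fin 3 → F) →ₗ[F] (Fin 7 → F)))
      (LinearMap.range (embB : (Fin 3 → F) →ₗ[F] (Fin 7 → F))) := by
  rw [Submodule.disjoint_def]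
  rintro _ ⟨a, rfl⟩ ⟨b, hb⟩
  rw [← (embA_add_embB_inj (show embA 0 + embB b = embA a + embB 0 by simp [hb])).1, map_zero]

theorem zornOrthogonal_of_mem_sup {p l : Submodule F (Fin 3 → F)} (hp : Module.finrank F p = 1)
    (hl : Module.finrank F l = 2) (hpl : p ≤ l) {x y : Fin 7 → F}
    (hx : x ∈ p.map embA ⊔ (perp l).map embB) (hy : y ∈ p.map embA ⊔ (perp l).map embB) :
    ZornOrthogonal x y := by
  obtain ⟨a, -, rfl⟩ := exists_span_of_finrank_one hp
  obtain ⟨b, -, hb⟩ := exists_span_of_finrank_one (W := perp l) (by rw [finrank_perp, hl])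
  have hab : a ⬝ᵥ b = 0 :=
    mem_perp.1 (hb ▸ Submodule.mem_span_singleton_self b) a
      (hpl (Submodule.mem_span_singleton_self a))
  rw [hb, Submodule.map_span, Submodule.map_span, Set.image_singleton, Set.image_singleton] at hx hy
  have h1 := zornOrthogonal_embA_embB.2 hab
  have haa := zornOrthogonal_self.2 (hexForm_embA a)
  have hbb := zornOrthogonal_self.2 (hexForm_embB b)
  obtain ⟨_, hu, _, hv, rfl⟩ := Submodule.mem_sup.1 hx
  obtain ⟨_, hw, _, hz, rfl⟩ := Submodule.mem_sup.1 hy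
  obtain ⟨s, rfl⟩ := Submodule.mem_span_singleton.1 hu
  obtain ⟨t, rfl⟩ := Submodule.mem_span_singleton.1 hv
  obtain ⟨s', rfl⟩ := Submodule.mem_span_singleton.1 hw
  obtain ⟨t', rfl⟩ := Submodule.mem_span_singleton.1 hz
  have ha : ZornOrthogonal (s • embA a + t • embB b) (embA a) :=
    ((haa.smul_right s).add_right (h1.smul_right t)).symm
  have hb : ZornOrthogonal (s • embA a + t • embB b) (embB b) :=
    ((h1.symm.smul_right s).add_right (hbb.smul_right t)).symm
  exact (ha.smul_right s').add_right (hb.smul_right t')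

theorem finrank_sup_map {p l : Submodule F (Fin 3 → F)} (hp : Module.finrank F p = 1)
    (hl : Module.finrank F l = 2) :
    Module.finrank F (p.map embA ⊔ (perp l).map embB : Submodule F (Fin 7 → F)) = 2 := by
  have h1 := Submodule.finrank_sup_add_finrank_inf_eq (p.map embA) ((perp l).map embB)
  have h2 : p.map embA ⊓ (perp l).map embB = ⊥ :=
    (disjoint_range_embA_range_embB.mono LinearMap.map_le_range LinearMap.map_le_range).eq_bot
  rw [h2, finrank_bot, finrank_map_of_injective embA_injective, hp,
    finrank_map_of_injective embB_injective, finrank_perp, hl] at h1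
  simpa using h1

/-- The point of the standard subhexagon attached to a flag of the projective plane. -/
def standardPoint (f : (hexagonQOne F).Point) : (standardSubhexagon (F := F)).toGeometry.Point :=
  ⟨mkHexPoint (f.1.1.1.map embA ⊔ (perp f.1.2.1).map embB) (finrank_sup_map f.1.1.2 f.1.2.2)
    (fun _ hx _ hy => zornOrthogonal_of_mem_sup f.1.1.2 f.1.2.2 f.2 hx hy), by
    have hp := (standardLine (Sum.inl f.1.1)).1.2.1
    have hl := (standardLine (Sum.inr f.1.2)).1.2.1
    constructor
    · intro h
      have h1 : f.1.1.1.map embA ≤ (⊥ : Submodule F (Fin 7 → F)) :=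
        h ▸ le_inf le_sup_left LinearMap.map_le_range
      change Module.finrank F (f.1.1.1.map embA) = 1 at hp
      rw [le_bot_iff.1 h1, finrank_bot] at hp
      omega
    · intro h
      have h1 : (perp f.1.2.1).map embB ≤ (⊥ : Submodule F (Fin 7 → F)) :=
        h ▸ le_inf le_sup_right LinearMap.map_le_range
      change Module.finrank F ((perp f.1.2.1).map embB) = 1 at hl
      rw [le_bot_iff.1 h1, finrank_bot] at hl
      omega⟩

theorem standardPoint_coe (f : (hexagonQOne F).Point) :
    (standardPoint f).1.1 = f.1.1.1.map embA ⊔ (perp f.1.2.1).map embB := rfl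

theorem standardLine_injective : Function.Injective (standardLine (F := F)) := by
  intro x y hxy
  have h : (standardLine x).1.1 = (standardLine y).1.1 := by rw [hxy]
  rcases x with p | l <;> rcases y with p' | l'
  · exact congrArg Sum.inl (Subtype.ext (Submodule.map_injective_of_injective embA_injective h))
  · exact absurd h.le (map_embA_ne_map_embB p.2)
  · exact absurd h.ge (map_embA_ne_map_embB p'.2)
  · have := congrArg perp (Submodule.map_injective_of_injective embB_injective h)
    rw [perp_perp, perp_perp] at this
    exact congrArg Sum.inr (Subtype.ext this)

theorem standardLine_surjective : Function.Surjective (standardLine (F := F)) := by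
  rintro ⟨l, hl | hl⟩
  · have h1 : (l.1.comap embA).map embA = l.1 := Submodule.map_comap_eq_self hl
    have h2 : Module.finrank F (l.1.comap embA) = 1 := by
      rw [← finrank_map_of_injective embA_injective, h1, l.2.1]
    exact ⟨Sum.inl ⟨_, h2⟩, Subtype.ext (Subtype.ext h1)⟩
  · have h1 : (l.1.comap embB).map embB = l.1 := Submodule.map_comap_eq_self hl
    have h2 : Module.finrank F (l.1.comap embB) = 1 := by
      rw [← finrank_map_of_injective embB_injective, h1, l.2.1]
    refine ⟨Sum.inr ⟨perp (l.1.comap embB), by rw [finrank_perp, h2]⟩,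
      Subtype.ext (Subtype.ext ?_)⟩
    change (perp (perp (l.1.comap embB))).map embB = l.1
    rw [perp_perp, h1]

theorem standardPoint_injective : Function.Injective (standardPoint (F := F)) := by
  intro f g hfg
  have h : (standardPoint f).1.1 = (standardPoint g).1.1 := by rw [hfg]
  rw [standardPoint_coe, standardPoint_coe] at h
  have h1 := congrArg (Submodule.comap embA) h
  have h2 := congrArg (fun W => perp (Submodule.comap embB W)) h
  simp only [comap_embA_sup, comap_embB_sup, perp_perp] at h1 h2
  exact Subtype.ext (Prod.ext (Subtype.ext h1) (Subtype.ext h2))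

/-- Nonzero vectors in the two intersections have dot product zero, hence define a flag, and they
span the given hexagon point for reasons of dimension. -/
theorem standardPoint_surjective : Function.Surjective (standardPoint (F := F)) := by
  rintro ⟨p, hA, hB⟩
  obtain ⟨_, ⟨hx, a, rfl⟩, ha0⟩ := Submodule.exists_mem_ne_zero_of_ne_bot hA
  obtain ⟨_, ⟨hy, b, rfl⟩, hb0⟩ := Submodule.exists_mem_ne_zero_of_ne_bot hB
  have hab := zornOrthogonal_embA_embB.1 (zornOrthogonal_of_mem p hx hy)
  have ha : a ≠ 0 := fun h => ha0 (by rw [h, map_zero])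
  have hb : b ≠ 0 := fun h => hb0 (by rw [h, map_zero])
  have h1 := finrank_span_singleton (K := F) ha
  have h2 : Module.finrank F (perp (F ∙ b)) = 2 := by
    rw [finrank_perp, finrank_span_singleton hb]
  have hle : F ∙ a ≤ perp (F ∙ b) := by
    rw [Submodule.span_singleton_le_iff_mem, mem_perp]
    intro c hc
    obtain ⟨t, rfl⟩ := Submodule.mem_span_singleton.1 hc
    rw [smul_dotProduct, dotProduct_comm, hab, smul_zero]
  refine ⟨⟨(⟨_, h1⟩, ⟨_, h2⟩), hle⟩, Subtype.ext (Subtype.ext ?_)⟩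
  change (F ∙ a).map embA ⊔ (perp (perp (F ∙ b))).map embB = p.1
  refine Submodule.eq_of_le_of_finrank_eq (sup_le ?_ ?_) ?_
  · rw [Submodule.map_span, Set.image_singleton, Submodule.span_singleton_le_iff_mem]
    exact hx
  · rw [perp_perp, Submodule.map_span, Set.image_singleton, Submodule.span_singleton_le_iff_mem]
    exact hy
  · rw [finrank_sup_map h1 h2, p.2.1]

theorem standardPoint_inc_standardLine (f : (hexagonQOne F).Point) (e : (hexagonQOne F).Line) :
    (hexagonQOne F).Inc f e ↔
      (standardSubhexagon (F := F)).toGeometry.Inc (standardPoint f) (standardLine e) := by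
  change _ ↔ (standardLine e).1.1 ≤ (standardPoint f).1.1
  rw [standardPoint_coe]
  constructor
  · rintro (rfl | rfl)
    · exact le_sup_left
    · exact le_sup_right
  · intro h
    rcases e with p | l
    · have h1 := Submodule.map_le_iff_le_comap.1 h
      rw [comap_embA_sup] at h1
      exact Or.inl (congrArg Sum.inl (Subtype.ext (Submodule.eq_of_le_of_finrank_eq h1
        (p.2.trans f.1.1.2.symm))))
    · have h1 := Submodule.map_le_iff_le_comap.1 h
      rw [comap_embB_sup] at h1
      have h2 := Submodule.eq_of_le_of_finrank_eq h1 (by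
        rw [finrank_perp, finrank_perp, l.2, f.1.2.2])
      have h3 := congrArg perp h2
      rw [perp_perp, perp_perp] at h3
      exact Or.inr (congrArg Sum.inr (Subtype.ext h3))

theorem standardSubhexagon_isIsomorphic :
    (standardSubhexagon (F := F)).toGeometry.IsIsomorphic (hexagonQOne F) :=
  ⟨Iso.symm
    { onPoints := Equiv.ofBijective _ ⟨standardPoint_injective, standardPoint_surjective⟩
      onLines := Equiv.ofBijective _ ⟨standardLine_injective, standardLine_surjective⟩
      inc_iff := standardPoint_inc_standardLine }⟩

end StandardSubhexagon

/-! ### Realizations of the plane by singular vectors. -/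

section Realization

variable {F : Type u} [Field F]

/-- The surviving coordinates 0, 5, 6 span a totally singular 3-space, the hexagon plane of `hexE₀`,
which contains all hexagon points through that vector. -/
theorem zornOrthogonal_hexE₀_left {c : F} (hc : c ≠ 0) {x : Fin 7 → F}
    (h : ZornOrthogonal (c • hexE₀) x) : x 1 = 0 ∧ x 2 = 0 ∧ x 3 = 0 ∧ x 4 = 0 := by
  have := (h.symm.of_smul_right hc).symm
  simp [ZornOrthogonal, hexE₀] at this
  simp [this]

/-- By transitivity `k` may be taken to be `hexE₀`, and then both vectors lie in its totally
singular hexagon plane. -/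
theorem hexPolar_eq_zero_of_zornOrthogonal {k u w : Fin 7 → F} (hk : k ≠ 0) (hkk : hexForm k = 0)
    (hu : ZornOrthogonal k u) (hw : ZornOrthogonal k w) : hexPolar u w = 0 := by
  obtain ⟨g, hg, hgk⟩ := exists_isHexAut_of_ne_zero hkk hk
  rw [← hg.zornOrthogonal_iff, hgk] at hu hw
  rw [← hg.hexPolar_apply]
  rw [← one_smul F hexE₀] at hu hw
  have hu' := zornOrthogonal_hexE₀_left one_ne_zero hu
  have hw' := zornOrthogonal_hexE₀_left one_ne_zero hw
  simp [hexPolar, hu', hw']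

theorem zornOrthogonal_hexE₄_left {c : F} (hc : c ≠ 0) {x : Fin 7 → F}
    (h : ZornOrthogonal (c • hexE₄) x) : x 5 = 0 ∧ x 6 = 0 ∧ x 3 = 0 ∧ x 0 = 0 := by
  have := (h.symm.of_smul_right hc).symm
  simp [ZornOrthogonal, hexE₄] at this
  simp [this]

/-- Two independent linear equations in two unknowns. -/
theorem eq_zero_of_det_ne_zero {a b c d s t : F} (hD : a * d - b * c ≠ 0) (h1 : a * s + b * t = 0)
    (h2 : c * s + d * t = 0) : s = 0 ∧ t = 0 := by
  constructor
  · refine (mul_eq_zero.1 (?_ : (a * d - b * c) * s = 0)).resolve_left hD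
    linear_combination d * h1 - b * h2
  · refine (mul_eq_zero.1 (?_ : (a * d - b * c) * t = 0)).resolve_left hD
    linear_combination a * h2 - c * h1

theorem exists_eq_mul_of_det_eq_zero {a b c d : F} (h0 : ¬ (a = 0 ∧ b = 0))
    (hD : a * d - b * c = 0) : ∃ t, c = t * a ∧ d = t * b := by
  by_cases ha : a = 0
  · have hb : b ≠ 0 := fun h => h0 ⟨ha, h⟩
    subst ha
    refine ⟨d / b, ?_, by field_simp⟩
    have : b * c = 0 := by linear_combination -hD
    simpa [hb] using this
  · refine ⟨c / a, by field_simp, ?_⟩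
    field_simp
    linear_combination hD

/-- Two points of the hexagon plane of `hexE₀` that are not on a common hexagon point through
`hexE₀` have no further common neighbor. -/
theorem eq_smul_hexE₀_of_zornOrthogonal {u w k : Fin 7 → F}
    (hu : u 1 = 0 ∧ u 2 = 0 ∧ u 3 = 0 ∧ u 4 = 0) (hw : w 1 = 0 ∧ w 2 = 0 ∧ w 3 = 0 ∧ w 4 = 0)
    (hD : u 5 * w 6 - u 6 * w 5 ≠ 0) (huk : ZornOrthogonal u k) (hwk : ZornOrthogonal w k) :
    k = k 0 • hexE₀ := by
  obtain ⟨u1, u2, u3, u4⟩ := hu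
  obtain ⟨w1, w2, w3, w4⟩ := hw
  simp only [ZornOrthogonal, u1, u2, u3, u4, w1, w2, w3, w4] at huk hwk
  obtain ⟨⟨a1, a2, a3⟩, ⟨a4, a5, a6⟩, a7, a8⟩ := huk
  obtain ⟨⟨b1, b2, b3⟩, ⟨b4, b5, b6⟩, b7, b8⟩ := hwk
  obtain ⟨k1, k2⟩ := eq_zero_of_det_ne_zero (s := k 1) (t := k 2) hD
    (by linear_combination a8) (by linear_combination b8)
  have k3 : k 3 = 0 := by
    refine (mul_eq_zero.1 (?_ : (u 5 * w 6 - u 6 * w 5) * k 3 = 0)).resolve_left hD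
    linear_combination w 6 * a2 - u 6 * b2 + (w 6 * u 0 - u 6 * w 0) * k2
  have k4 : k 4 = 0 := by
    refine (mul_eq_zero.1 (?_ : (u 5 * w 6 - u 6 * w 5) * k 4 = 0)).resolve_left hD
    linear_combination w 5 * a5 * (-1) - w 6 * a6
  obtain ⟨k6, k5⟩ := eq_zero_of_det_ne_zero (s := k 6) (t := -k 5) hD
    (by linear_combination a4 + u 0 * k3) (by linear_combination b4 + w 0 * k3)
  rw [neg_eq_zero] at k5
  ext i
  fin_cases i <;> simp [hexE₀, k1, k2, k3, k4, k5, k6]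

/-- A realization of the projective plane by singular vectors: incident elements are realized by
vectors spanning a hexagon point that contains no other element. -/
structure IsPlaneRealization
    (v : (projectivePlane F).Point ⊕ (projectivePlane F).Line → Fin 7 → F) : Prop where
  ne_zero : ∀ x, v x ≠ 0
  hexForm_eq_zero : ∀ x, hexForm (v x) = 0
  zornOrthogonal : ∀ {x y}, (projectivePlane F).incidenceGraph.Adj x y → ZornOrthogonal (v x) (v y)
  ne_smul : ∀ {x y}, x ≠ y → ∀ c : F, v x ≠ c • v y
  ne_add : ∀ {x y z}, (projectivePlane F).incidenceGraph.Adj x y → z ≠ x → z ≠ y →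
    ∀ a b : F, v z ≠ a • v x + b • v y

variable {v : (projectivePlane F).Point ⊕ (projectivePlane F).Line → Fin 7 → F}

theorem IsPlaneRealization.comp (hv : IsPlaneRealization v) {g : (Fin 7 → F) ≃ₗ[F] (Fin 7 → F)}
    (hg : IsHexAut g) : IsPlaneRealization (fun x => g (v x)) where
  ne_zero x := by simpa using hv.ne_zero x
  hexForm_eq_zero x := (hg.hexForm_apply _).trans (hv.hexForm_eq_zero x)
  zornOrthogonal h := (hg.zornOrthogonal_iff _ _).2 (hv.zornOrthogonal h)
  ne_smul h c := by
    rw [← map_smul, g.injective.ne_iff]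
    exact hv.ne_smul h c
  ne_add h h1 h2 a b := by
    rw [← map_smul, ← map_smul, ← map_add, g.injective.ne_iff]
    exact hv.ne_add h h1 h2 a b

section Finite

variable [Finite F]

theorem IsPlaneRealization.hexPolar_eq_zero (hv : IsPlaneRealization v)
    {x y : (projectivePlane F).Point ⊕ (projectivePlane F).Line} (hxy : x.isLeft = y.isLeft) :
    hexPolar (v x) (v y) = 0 := by
  obtain ⟨c, hx, hy⟩ := isProjectivePlane_projectivePlane.exists_common_neighbor hxy
  exact hexPolar_eq_zero_of_zornOrthogonal (hv.ne_zero c) (hv.hexForm_eq_zero c)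
    (hv.zornOrthogonal hx.symm) (hv.zornOrthogonal hy.symm)

theorem exists_adj_ne (a b : (projectivePlane F).Point ⊕ (projectivePlane F).Line) :
    ∃ c, (projectivePlane F).incidenceGraph.Adj a c ∧ c ≠ b := by
  have hP := isProjectivePlane_projectivePlane (F := F)
  have hq : 1 < Nat.card F + 1 := by
    have := Nat.card_pos (α := F)
    omega
  have key : ∀ {α : Type u} (s : Set α) (f : α → (projectivePlane F).Point ⊕ (projectivePlane F).Line)
      (_ : Function.Injective f), s.ncard = Nat.card F + 1 → ∃ x ∈ s, f x ≠ b := by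
    intro α s f hf hs
    obtain ⟨x, hx, y, hy, hxy⟩ := (Set.one_lt_ncard (Set.finite_of_ncard_pos (by omega))).1 (hs ▸ hq)
    by_cases h : f x = b
    · exact ⟨y, hy, fun h' => hxy (hf (h.trans h'.symm))⟩
    · exact ⟨x, hx, h⟩
  rcases a with p | l
  · obtain ⟨l, hl, h⟩ := key _ Sum.inr Sum.inr_injective (hP.card_lines_through_point p)
    exact ⟨_, incidenceGraph_adj_inl_inr.2 hl, h⟩
  · obtain ⟨p, hp, h⟩ := key _ Sum.inl Sum.inl_injective (hP.card_points_on_line l)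
    exact ⟨_, incidenceGraph_adj_inr_inl.2 hp, h⟩

/-- A realization contains a pair of non-orthogonal vectors. -/
theorem IsPlaneRealization.exists_hexPolar_ne_zero (hv : IsPlaneRealization v) :
    ∃ x y, hexPolar (v x) (v y) ≠ 0 := by
  by_contra! hall
  obtain ⟨x⟩ : Nonempty ((projectivePlane F).Point ⊕ (projectivePlane F).Line) := by
    obtain ⟨x, _⟩ := (isProjectivePlane_projectivePlane (F := F)).exists_triangle
    exact ⟨Sum.inl x⟩
  obtain ⟨g, hg, hgx⟩ := exists_isHexAut_of_ne_zero (hv.hexForm_eq_zero x) (hv.ne_zero x)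
  replace hall := fun x y => (hg.hexPolar_apply (v x) (v y)).trans (hall x y)
  replace hv := hv.comp hg
  set w := fun x => g (v x) with hw
  have hx : w x = (1 : F) • hexE₀ := by rw [one_smul]; exact hgx
  -- The contradiction comes from the path `z, x, y, y₁, y₂`, in which `x` is realized by `hexE₀`.
  obtain ⟨y, hxy, -⟩ := exists_adj_ne x x
  obtain ⟨z, hxz, hzy⟩ := exists_adj_ne x y
  obtain ⟨y₁, hyy, hy1⟩ := exists_adj_ne y x
  obtain ⟨y₂, hy12, hy2⟩ := exists_adj_ne y₁ y
  have hy2x : y₂ ≠ x := by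
    rintro rfl
    have h1 := isLeft_ne_of_adj hxy
    have h2 := isLeft_ne_of_adj hyy
    have h3 := isLeft_ne_of_adj hy12
    revert h1 h2 h3
    cases y.isLeft <;> cases y₁.isLeft <;> cases y₂.isLeft <;> simp
  have cy := zornOrthogonal_hexE₀_left one_ne_zero (hx ▸ hv.zornOrthogonal hxy)
  have cz := zornOrthogonal_hexE₀_left one_ne_zero (hx ▸ hv.zornOrthogonal hxz)
  have hy0 : ¬ (w y 5 = 0 ∧ w y 6 = 0) := by
    rintro ⟨h5, h6⟩
    refine hv.ne_smul hxy.ne.symm (w y 0) ?_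
    rw [hx]
    ext i
    fin_cases i <;> simp [hexE₀, cy, h5, h6]
  -- Modulo `hexE₀` the vector of `z` is not a multiple of that of `y`; otherwise it would lie in
  -- the hexagon point spanned by `x` and `y`.
  have hdet : ∀ z, z ≠ x → z ≠ y → w z 1 = 0 ∧ w z 2 = 0 ∧ w z 3 = 0 ∧ w z 4 = 0 →
      w y 5 * w z 6 - w y 6 * w z 5 ≠ 0 := by
    intro z hzx hzy cz hD
    obtain ⟨t, h5, h6⟩ := exists_eq_mul_of_det_eq_zero hy0 hD
    refine hv.ne_add hxy hzx hzy (w z 0 - t * w y 0) t ?_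
    rw [hx]
    ext i
    fin_cases i <;> simp [hexE₀, cy, cz, h5, h6]
  have hDz := hdet z hxz.ne.symm hzy cz
  -- If everything is orthogonal, `y₂` is orthogonal to the hexagon plane spanned by `x`, `y`, `z`.
  -- Being singular, it lies in that plane, and then its common neighbor `y₁` with `y` can only be
  -- `x`.
  have cy2 : w y₂ 1 = 0 ∧ w y₂ 2 = 0 ∧ w y₂ 3 = 0 ∧ w y₂ 4 = 0 := by
    have h1 : hexPolar (w y) (w y₂) = 0 := hall y y₂
    have h2 : hexPolar (w z) (w y₂) = 0 := hall z y₂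
    have h3 : hexPolar (w x) (w y₂) = 0 := hall x y₂
    simp [hexPolar, hx, hexE₀] at h3
    simp [hexPolar, cy, h3] at h1
    simp [hexPolar, cz, h3] at h2
    obtain ⟨e1, e2⟩ := eq_zero_of_det_ne_zero hDz h1 h2
    have h4 : hexForm (w y₂) = 0 := hv.hexForm_eq_zero y₂
    simp [hexForm, h3, e1, e2] at h4
    exact ⟨e1, e2, h4, h3⟩
  have hk := eq_smul_hexE₀_of_zornOrthogonal cy cy2 (hdet y₂ hy2x hy2 cy2)
    (hv.zornOrthogonal hyy) (hv.zornOrthogonal hy12.symm)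
  refine hv.ne_smul hy1 (w y₁ 0) ?_
  rw [hx, one_smul]
  exact hk

/-- A realization containing the two standard vectors lies in the two standard planes. -/
theorem IsPlaneRealization.mem_range (hv : IsPlaneRealization v)
    {x y : (projectivePlane F).Point ⊕ (projectivePlane F).Line} {c d : F}
    (hx : v x = c • hexE₀) (hy : v y = d • hexE₄) :
    x.isLeft ≠ y.isLeft ∧
      (∀ z, z.isLeft = x.isLeft → v z ∈ LinearMap.range (embA : (Fin 3 → F) →ₗ[F] (Fin 7 → F))) ∧
      ∀ z, z.isLeft = y.isLeft → v z ∈ LinearMap.range (embB : (Fin 3 → F) →ₗ[F] (Fin 7 → F)) := by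
  have hc : c ≠ 0 := by
    rintro rfl
    exact hv.ne_zero x (by rw [hx, zero_smul])
  have hd : d ≠ 0 := by
    rintro rfl
    exact hv.ne_zero y (by rw [hy, zero_smul])
  have hcd : hexPolar (v x) (v y) ≠ 0 := by
    rw [hx, hy]
    simp [hexPolar, hexE₀, hexE₄, hc, hd]
  have htype : x.isLeft ≠ y.isLeft := fun h => hcd (hv.hexPolar_eq_zero h)
  -- A neighbor of `x` has the type of `y`, so it is orthogonal to `hexE₄`. This removes coordinate
  -- 0 from the hexagon plane of `hexE₀` and leaves only coordinates 5 and 6.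
  have nx : ∀ z, (projectivePlane F).incidenceGraph.Adj x z →
      (v z 1 = 0 ∧ v z 2 = 0 ∧ v z 3 = 0 ∧ v z 4 = 0) ∧ v z 0 = 0 := by
    intro z hz
    have h1 := zornOrthogonal_hexE₀_left hc (hx ▸ hv.zornOrthogonal hz)
    have h2 : hexPolar (v y) (v z) = 0 := hv.hexPolar_eq_zero (by
      have := isLeft_ne_of_adj hz
      revert this htype
      cases x.isLeft <;> cases y.isLeft <;> cases z.isLeft <;> simp)
    rw [hy] at h2
    simp [hexPolar, hexE₄, hd] at h2
    exact ⟨h1, h2⟩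
  have ny : ∀ z, (projectivePlane F).incidenceGraph.Adj y z →
      (v z 5 = 0 ∧ v z 6 = 0 ∧ v z 3 = 0 ∧ v z 0 = 0) ∧ v z 4 = 0 := by
    intro z hz
    have h1 := zornOrthogonal_hexE₄_left hd (hy ▸ hv.zornOrthogonal hz)
    have h2 : hexPolar (v x) (v z) = 0 := hv.hexPolar_eq_zero (by
      have := isLeft_ne_of_adj hz
      revert this htype
      cases x.isLeft <;> cases y.isLeft <;> cases z.isLeft <;> simp)
    rw [hx] at h2
    simp [hexPolar, hexE₀, hc] at h2
    exact ⟨h1, h2⟩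
  obtain ⟨x₁, hx1, -⟩ := exists_adj_ne x x
  obtain ⟨x₂, hx2, hx12⟩ := exists_adj_ne x x₁
  obtain ⟨y₁, hy1, -⟩ := exists_adj_ne y y
  obtain ⟨y₂, hy2, hy12⟩ := exists_adj_ne y y₁
  have dx : v x₁ 5 * v x₂ 6 - v x₁ 6 * v x₂ 5 ≠ 0 := by
    intro hD
    obtain ⟨⟨a1, a2, a3, a4⟩, a0⟩ := nx x₁ hx1
    obtain ⟨⟨b1, b2, b3, b4⟩, b0⟩ := nx x₂ hx2
    obtain ⟨t, h5, h6⟩ := exists_eq_mul_of_det_eq_zero (a := v x₁ 5) (b := v x₁ 6) (fun h =>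
      hv.ne_zero x₁ (by ext i; fin_cases i <;> simp [*])) hD
    exact hv.ne_smul hx12 t (by ext i; fin_cases i <;> simp [*])
  have dy : v y₁ 1 * v y₂ 2 - v y₁ 2 * v y₂ 1 ≠ 0 := by
    intro hD
    obtain ⟨⟨a1, a2, a3, a4⟩, a0⟩ := ny y₁ hy1
    obtain ⟨⟨b1, b2, b3, b4⟩, b0⟩ := ny y₂ hy2
    obtain ⟨t, h5, h6⟩ := exists_eq_mul_of_det_eq_zero (a := v y₁ 1) (b := v y₁ 2) (fun h =>
      hv.ne_zero y₁ (by ext i; fin_cases i <;> simp [*])) hD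
    exact hv.ne_smul hy12 t (by ext i; fin_cases i <;> simp [*])
  refine ⟨htype, fun z hz => ?_, fun z hz => ?_⟩
  -- The neighbors of `y` have the type of `z` and live in coordinates 1 and 2. Orthogonality to two
  -- independent ones kills coordinates 5 and 6 of `v z`.
  · have key : ∀ m, (projectivePlane F).incidenceGraph.Adj y m →
        v m 1 * v z 5 + v m 2 * v z 6 = 0 := by
      intro m hm
      have h2 : hexPolar (v m) (v z) = 0 := hv.hexPolar_eq_zero (by
        have := isLeft_ne_of_adj hm
        revert this htype hz
        cases x.isLeft <;> cases y.isLeft <;> cases z.isLeft <;> cases m.isLeft <;> simp)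
      obtain ⟨⟨a1, a2, a3, a4⟩, a0⟩ := ny m hm
      simpa [hexPolar, a1, a2, a3, a4, a0] using h2
    obtain ⟨z5, z6⟩ := eq_zero_of_det_ne_zero dy (key y₁ hy1) (key y₂ hy2)
    -- A common neighbor of `x` and `z` lives in coordinates 5 and 6; its vanishing product with `v
    -- z` kills coordinates 3 and 4.
    obtain ⟨m, hm, hzm⟩ := isProjectivePlane_projectivePlane.exists_common_neighbor hz.symm
    obtain ⟨⟨a1, a2, a3, a4⟩, a0⟩ := nx m hm
    have hmz := hv.zornOrthogonal hzm.symm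
    simp [ZornOrthogonal, a1, a2, a3, a4, a0, z5, z6] at hmz
    have h56 : ¬ (v m 5 = 0 ∧ v m 6 = 0) := by
      rintro ⟨h5, h6⟩
      exact hv.ne_zero m (by ext i; fin_cases i <;> simp [*])
    rw [mem_range_embA]
    grind
  · have key : ∀ m, (projectivePlane F).incidenceGraph.Adj x m →
        v m 5 * v z 1 + v m 6 * v z 2 = 0 := by
      intro m hm
      have h2 : hexPolar (v m) (v z) = 0 := hv.hexPolar_eq_zero (by
        have := isLeft_ne_of_adj hm
        revert this htype hz
        cases x.isLeft <;> cases y.isLeft <;> cases z.isLeft <;> cases m.isLeft <;> simp)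
      obtain ⟨⟨a1, a2, a3, a4⟩, a0⟩ := nx m hm
      simpa [hexPolar, a1, a2, a3, a4, a0] using h2
    obtain ⟨z1, z2⟩ := eq_zero_of_det_ne_zero dx (key x₁ hx1) (key x₂ hx2)
    obtain ⟨m, hm, hzm⟩ := isProjectivePlane_projectivePlane.exists_common_neighbor hz.symm
    obtain ⟨⟨a1, a2, a3, a4⟩, a0⟩ := ny m hm
    have hmz := hv.zornOrthogonal hzm.symm
    simp [ZornOrthogonal, a1, a2, a3, a4, a0, z1, z2] at hmz
    have h56 : ¬ (v m 1 = 0 ∧ v m 2 = 0) := by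
      rintro ⟨h5, h6⟩
      exact hv.ne_zero m (by ext i; fin_cases i <;> simp [*])
    rw [mem_range_embB]
    grind

end Finite

end Realization

/-! ### A hyperbolic pair lies in exactly one subgeometry of the required type. -/

section Uniqueness

variable {F : Type u} [Field F]

/-- A subgeometry isomorphic to the flag geometry of the projective plane defines a
realization. -/
theorem exists_isPlaneRealization {S : Subgeometry (dualSplitCayleyHexagon F)}
    (θ : Iso S.toGeometry (hexagonQOne F)) :
    ∃ v, IsPlaneRealization v ∧ (∀ l ∈ S.lines, ∃ x, l.1 = F ∙ v x) ∧
      (∀ x, ∃ l ∈ S.lines, l.1 = F ∙ v x) ∧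
      ∀ p ∈ S.points, ∀ b : Bool, ∃ x, x.isLeft = b ∧ v x ∈ p.1 := by
  let Φ : (projectivePlane F).Point ⊕ (projectivePlane F).Line → S.lines := θ.onLines.symm
  have hΦ : Function.Injective Φ := θ.onLines.symm.injective
  choose v hv0 hvQ hv using fun x => exists_eq_mkHexLine (Φ x).1
  have hspan : ∀ x, (Φ x).1.1 = F ∙ (v x) := fun x => congrArg Subtype.val (hv x)
  have hle : ∀ x (p : (dualSplitCayleyHexagon F).Point), (Φ x).1.1 ≤ p.1 ↔ v x ∈ p.1 :=
    fun x p => by rw [hspan, Submodule.span_singleton_le_iff_mem]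
  have hinc : ∀ (f : (projectivePlane F).flagGeometry.Point)
      (x : (projectivePlane F).Point ⊕ (projectivePlane F).Line),
      (projectivePlane F).flagGeometry.Inc f x ↔ v x ∈ (θ.onPoints.symm f).1.1 :=
    fun f x => (θ.symm.inc_iff f x).trans (hle x _)
  refine ⟨v, ⟨hv0, hvQ, ?_, ?_, ?_⟩, ?_, ?_, ?_⟩
  · intro x y hxy
    obtain ⟨f, hx, hy⟩ := exists_flag_of_adj hxy
    exact zornOrthogonal_of_mem _ ((hinc f x).1 hx) ((hinc f y).1 hy)
  · intro x y hxy c h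
    apply hxy
    apply hΦ
    refine Subtype.ext (Subtype.ext ?_)
    refine Submodule.eq_of_le_of_finrank_eq ?_ ((Φ x).1.2.1.trans (Φ y).1.2.1.symm)
    rw [hspan, hspan, Submodule.span_singleton_le_iff_mem, h]
    exact Submodule.smul_mem _ _ (Submodule.mem_span_singleton_self _)
  · intro x y z hxy hzx hzy a b h
    obtain ⟨f, hx, hy⟩ := exists_flag_of_adj hxy
    have hz : (projectivePlane F).flagGeometry.Inc f z := by
      rw [hinc, h]
      exact Submodule.add_mem _ (Submodule.smul_mem _ _ ((hinc f x).1 hx))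
        (Submodule.smul_mem _ _ ((hinc f y).1 hy))
    -- Three distinct elements on one flag would be pairwise of different types, but there are only
    -- two types.
    have h1 := isLeft_ne_of_adj hxy
    have h2 := isLeft_ne_of_adj (adj_of_flagGeometry_inc hz hx hzx)
    have h3 := isLeft_ne_of_adj (adj_of_flagGeometry_inc hz hy hzy)
    revert h1 h2 h3
    cases x.isLeft <;> cases y.isLeft <;> cases z.isLeft <;> simp
  · intro l hl
    exact ⟨θ.onLines ⟨l, hl⟩, (congrArg (fun m => m.1.1)
      (θ.onLines.symm_apply_apply ⟨l, hl⟩)).symm.trans (hspan _)⟩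
  · exact fun x => ⟨_, (Φ x).2, hspan x⟩
  · intro p hp b
    obtain ⟨z, hz, hfz⟩ := flagGeometry_exists_inc (θ.onPoints ⟨p, hp⟩) b
    have h1 := (hinc _ _).1 hfz
    have h2 : (θ.onPoints.symm (θ.onPoints ⟨p, hp⟩)).1 = p :=
      congrArg Subtype.val (θ.onPoints.symm_apply_apply ⟨p, hp⟩)
    exact ⟨z, hz, h2 ▸ h1⟩

/-- A subgeometry covers a vector if the vector lies in one of its lines. -/
def Covers (S : Subgeometry (dualSplitCayleyHexagon F)) (x : Fin 7 → F) : Prop :=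
  ∃ l ∈ S.lines, x ∈ l.1

theorem covers_map {S : Subgeometry (dualSplitCayleyHexagon F)} {g : (Fin 7 → F) ≃ₗ[F] (Fin 7 → F)}
    {hg : IsHexAut g} {x : Fin 7 → F} : Covers (S.map (hexIso g hg)) (g x) ↔ Covers S x := by
  constructor
  · rintro ⟨_, ⟨l, hl, rfl⟩, y, hy, hyx⟩
    exact ⟨l, hl, g.injective hyx ▸ hy⟩
  · rintro ⟨l, hl, hx⟩
    exact ⟨_, ⟨l, hl, rfl⟩, x, hx, rfl⟩

theorem covers_standardSubhexagon {x : Fin 7 → F} (h0 : x ≠ 0) : Covers standardSubhexagon x ↔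
    x ∈ LinearMap.range (embA : (Fin 3 → F) →ₗ[F] (Fin 7 → F)) ∨
      x ∈ LinearMap.range (embB : (Fin 3 → F) →ₗ[F] (Fin 7 → F)) := by
  constructor
  · rintro ⟨l, hl | hl, hx⟩
    · exact Or.inl (hl hx)
    · exact Or.inr (hl hx)
  · intro h
    have hx : hexForm x = 0 := by
      rcases h with ⟨a, rfl⟩ | ⟨a, rfl⟩
      · exact hexForm_embA a
      · exact hexForm_embB a
    refine ⟨mkHexLine x h0 hx, ?_, Submodule.mem_span_singleton_self x⟩
    rcases h with h | h
    · exact Or.inl ((Submodule.span_singleton_le_iff_mem _ _).2 h)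
    · exact Or.inr ((Submodule.span_singleton_le_iff_mem _ _).2 h)

theorem isIsomorphic_map {S : Subgeometry (dualSplitCayleyHexagon F)}
    (hS : S.toGeometry.IsIsomorphic (hexagonQOne F))
    (e : Iso (dualSplitCayleyHexagon F) (dualSplitCayleyHexagon F)) :
    (S.map e).toGeometry.IsIsomorphic (hexagonQOne F) :=
  hS.map fun θ => (S.isoMap e).symm.trans θ

section Finite

variable [Finite F]

instance : Finite (dualSplitCayleyHexagon F).Point :=
  inferInstanceAs (Finite {_W : Submodule F (Fin 7 → F) // _})

instance : Finite (dualSplitCayleyHexagon F).Line :=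
  inferInstanceAs (Finite {_W : Submodule F (Fin 7 → F) // _})

/-- Isomorphic subgeometries have equal cardinalities, so a single inclusion suffices. -/
theorem PointLineGeometry.Subgeometry.eq_of_le_of_iso {G : PointLineGeometry.{u, v}}
    {H : PointLineGeometry.{u', v'}}
    [Finite G.Point] [Finite G.Line] {S T : Subgeometry G} (e : Iso S.toGeometry H)
    (f : Iso T.toGeometry H) (h1 : S.points ⊆ T.points) (h2 : S.lines ⊆ T.lines) : S = T := by
  refine Subgeometry.ext (Set.eq_of_subset_of_ncard_le h1 ?_) (Set.eq_of_subset_of_ncard_le h2 ?_)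
  · rw [← Nat.card_coe_set_eq, ← Nat.card_coe_set_eq]
    exact (Nat.card_congr (f.onPoints.trans e.onPoints.symm)).le
  · rw [← Nat.card_coe_set_eq, ← Nat.card_coe_set_eq]
    exact (Nat.card_congr (f.onLines.trans e.onLines.symm)).le

/-- The realization lies in the two standard 3-spaces, and each point of `S` contains vectors of
both types; this is the inclusion of `S` in the standard example. -/
theorem eq_standardSubhexagon {S : Subgeometry (dualSplitCayleyHexagon F)}
    (hS : S.toGeometry.IsIsomorphic (hexagonQOne F)) (h0 : Covers S hexE₀) (h4 : Covers S hexE₄) :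
    S = standardSubhexagon := by
  obtain ⟨θ⟩ := hS
  obtain ⟨f⟩ := standardSubhexagon_isIsomorphic (F := F)
  obtain ⟨v, hv, hline, hspan, hpoint⟩ := exists_isPlaneRealization θ
  have hsmul : ∀ (x : Fin 7 → F), x ≠ 0 → Covers S x → ∃ z, ∃ c : F, v z = c • x := by
    rintro x hx ⟨l, hl, hxl⟩
    obtain ⟨z, hz⟩ := hline l hl
    refine ⟨z, ?_⟩
    rw [hz] at hxl
    obtain ⟨c, rfl⟩ := Submodule.mem_span_singleton.1 hxl
    have hc : c ≠ 0 := fun h => hx (by rw [h, zero_smul])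
    exact ⟨c⁻¹, by rw [inv_smul_smul₀ hc]⟩
  obtain ⟨x, c, hx⟩ := hsmul hexE₀ (fun h => one_ne_zero (congrFun h 0)) h0
  obtain ⟨y, d, hy⟩ := hsmul hexE₄ (fun h => one_ne_zero (congrFun h 4)) h4
  obtain ⟨hxy, hA, hB⟩ := hv.mem_range hx hy
  refine Subgeometry.eq_of_le_of_iso θ f ?_ ?_
  · intro p hp
    have hex : ∀ (b : Bool) (W : Submodule F (Fin 7 → F)), (∀ z, z.isLeft = b → v z ∈ W) →
        p.1 ⊓ W ≠ ⊥ := by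
      intro b W hW hbot
      obtain ⟨z, hz, hzp⟩ := hpoint p hp b
      have : v z ∈ p.1 ⊓ W := ⟨hzp, hW z hz⟩
      rw [hbot] at this
      exact hv.ne_zero z this
    exact ⟨hex _ _ hA, hex _ _ hB⟩
  · intro l hl
    obtain ⟨z, hz⟩ := hline l hl
    have hAB : z.isLeft = x.isLeft ∨ z.isLeft = y.isLeft := by
      revert hxy
      cases x.isLeft <;> cases y.isLeft <;> cases z.isLeft <;> simp
    change l.1 ≤ _ ∨ l.1 ≤ _
    rw [hz, Submodule.span_singleton_le_iff_mem, Submodule.span_singleton_le_iff_mem]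
    exact hAB.imp (hA _) (hB _)

theorem exists_covers {S : Subgeometry (dualSplitCayleyHexagon F)}
    (hS : S.toGeometry.IsIsomorphic (hexagonQOne F)) :
    ∃ x y, hexForm x = 0 ∧ hexForm y = 0 ∧ hexPolar x y = 1 ∧ Covers S x ∧ Covers S y := by
  obtain ⟨θ⟩ := hS
  obtain ⟨v, hv, -, hspan, -⟩ := exists_isPlaneRealization θ
  obtain ⟨x, y, hxy⟩ := hv.exists_hexPolar_ne_zero
  have hc : ∀ z (c : F), Covers S (c • v z) := fun z c =>
    let ⟨l, hl, hlz⟩ := hspan z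
    ⟨l, hl, by
      rw [hlz]
      exact Submodule.smul_mem _ _ (Submodule.mem_span_singleton_self _)⟩
  refine ⟨v x, (hexPolar (v x) (v y))⁻¹ • v y, hv.hexForm_eq_zero x, ?_, ?_, ?_, hc y _⟩
  · have := (zornOrthogonal_self.2 (hv.hexForm_eq_zero y)).smul_right (hexPolar (v x) (v y))⁻¹
    exact zornOrthogonal_self.1 (this.symm.smul_right _)
  · have : ∀ c : F, hexPolar (v x) (c • v y) = c * hexPolar (v x) (v y) := by
      intro c
      simp [hexPolar]
      ring
    rw [this, inv_mul_cancel₀ hxy]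
  · have := hc x 1
    rwa [one_smul] at this

/-- A hyperbolic pair of singular vectors is covered by exactly one subhexagon. -/
theorem isIsomorphic_and_covers_iff {S : Subgeometry (dualSplitCayleyHexagon F)}
    {g : (Fin 7 → F) ≃ₗ[F] (Fin 7 → F)} (hg : IsHexAut g) {x y : Fin 7 → F} (hx : g x = hexE₀)
    (hy : g y = hexE₄) : (S.toGeometry.IsIsomorphic (hexagonQOne F) ∧ Covers S x ∧ Covers S y) ↔
      S.map (hexIso g hg) = standardSubhexagon := by
  constructor
  · rintro ⟨hS, h1, h2⟩
    refine eq_standardSubhexagon (isIsomorphic_map hS _) ?_ ?_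
    · rw [← hx]
      exact covers_map.2 h1
    · rw [← hy]
      exact covers_map.2 h2
  · intro h
    refine ⟨?_, ?_, ?_⟩
    · rw [← S.map_symm_map (hexIso g hg), h]
      exact isIsomorphic_map standardSubhexagon_isIsomorphic _
    · rw [← covers_map (hg := hg), h, hx,
        covers_standardSubhexagon (fun h => one_ne_zero (congrFun h 0))]
      exact Or.inl (mem_range_embA.2 (by simp [hexE₀]))
    · rw [← covers_map (hg := hg), h, hy,
        covers_standardSubhexagon (fun h => one_ne_zero (congrFun h 4))]
      exact Or.inr (mem_range_embB.2 (by simp [hexE₄]))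

end Finite

end Uniqueness

/-! ### Double counting of hyperbolic pairs. -/

section Counting

theorem natCard_sigma_const {α : Type*} {β : α → Type*} [Finite α] [∀ a, Finite (β a)] {n m : ℕ}
    (hα : Nat.card α = n) (hβ : ∀ a, Nat.card (β a) = m) : Nat.card (Σ a, β a) = n * m := by
  have := Fintype.ofFinite α
  rw [Nat.card_sigma]
  simp [hβ, ← hα, Nat.card_eq_fintype_card]

theorem natCard_subtype_prod {α β : Type*} [Finite α] [Finite β] {P : α → Prop} {R : α → β → Prop}
    {n m : ℕ} (hP : Nat.card {a // P a} = n) (hR : ∀ a, P a → Nat.card {b // R a b} = m) :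
    Nat.card {p : α × β // P p.1 ∧ R p.1 p.2} = n * m := by
  rw [← natCard_sigma_const (β := fun a : {a // P a} => {b // R a.1 b}) hP fun a => hR a.1 a.2]
  exact Nat.card_congr
    { toFun := fun p => ⟨⟨p.1.1, p.2.1⟩, ⟨p.1.2, p.2.2⟩⟩
      invFun := fun s => ⟨(s.1.1, s.2.1), s.1.2, s.2.2⟩
      left_inv := fun _ => rfl
      right_inv := fun _ => rfl }

variable {F : Type u} [Field F]

/-- The solutions form a translate of a 2-dimensional subspace. -/
theorem natCard_dotProduct_eq {a : Fin 3 → F} (ha : a ≠ 0) (c : F) :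
    Nat.card {b : Fin 3 → F // a ⬝ᵥ b = c} = Nat.card F ^ 2 := by
  have h1 : Module.finrank F (F ∙ a) = 1 := finrank_span_singleton ha
  have h2 : Module.finrank F (perp (F ∙ a)) = 2 := by rw [finrank_perp, h1]
  have h3 : ∀ b, b ∈ perp (F ∙ a) ↔ a ⬝ᵥ b = 0 := by
    intro b
    rw [mem_perp]
    constructor
    · exact fun h => h a (Submodule.mem_span_singleton_self a)
    · intro h y hy
      obtain ⟨t, rfl⟩ := Submodule.mem_span_singleton.1 hy
      rw [smul_dotProduct, h, smul_zero]
  obtain ⟨b₀, hb₀⟩ : ∃ b₀ : Fin 3 → F, a ⬝ᵥ b₀ = c := by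
    obtain ⟨i, hi⟩ := Function.ne_iff.1 ha
    refine ⟨Pi.single i ((a i)⁻¹ * c), ?_⟩
    rw [dotProduct_single, mul_inv_cancel_left₀ hi]
  rw [← h2, ← Module.natCard_eq_pow_finrank]
  refine Nat.card_congr
    { toFun := fun b => ⟨b.1 - b₀, (h3 _).2 (by rw [dotProduct_sub, b.2, hb₀, sub_self])⟩
      invFun := fun b => ⟨b.1 + b₀, by rw [dotProduct_add, (h3 _).1 b.2, hb₀, zero_add]⟩
      left_inv := fun b => by simp
      right_inv := fun b => by simp }

theorem natCard_ne_zero_fin_three [Finite F] :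
    Nat.card {a : Fin 3 → F // a ≠ 0} = Nat.card F ^ 3 - 1 := by
  have := Fintype.ofFinite F
  classical
  rw [Nat.card_eq_fintype_card, Fintype.card_subtype_compl, Fintype.card_subtype_eq]
  simp [Nat.card_eq_fintype_card]

theorem natCard_dotProduct_eq_one [Finite F] :
    Nat.card {p : (Fin 3 → F) × (Fin 3 → F) // p.1 ⬝ᵥ p.2 = 1} =
      (Nat.card F ^ 3 - 1) * Nat.card F ^ 2 := by
  rw [← natCard_subtype_prod natCard_ne_zero_fin_three fun a ha => natCard_dotProduct_eq ha 1]
  refine Nat.card_congr (Equiv.subtypeEquivRight fun p => ⟨fun h => ⟨fun h0 => ?_, h⟩, And.right⟩)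
  rw [h0, zero_dotProduct] at h
  exact zero_ne_one h

/-- The coordinates of `F ^ 7` as two vectors and a scalar. -/
def splitEquiv : (Fin 7 → F) ≃ ((Fin 3 → F) × F) × (Fin 3 → F) where
  toFun x := ((![x 0, x 1, x 2], x 3), ![x 4, x 5, x 6])
  invFun p := ![p.1.1 0, p.1.1 1, p.1.1 2, p.1.2, p.2 0, p.2 1, p.2 2]
  left_inv x := by ext i; fin_cases i <;> rfl
  right_inv p := by
    refine Prod.ext (Prod.ext ?_ rfl) ?_ <;> ext i <;> fin_cases i <;> rfl

theorem hexForm_eq_zero_iff {x : Fin 7 → F} : hexForm x = 0 ↔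
    (splitEquiv x).1.1 ⬝ᵥ (splitEquiv x).2 = (splitEquiv x).1.2 ^ 2 := by
  simp [hexForm, splitEquiv, dotProduct, Fin.sum_univ_three, sub_eq_zero]

/-- If the first three coordinates are not all zero, coordinate 3 is free and the last three satisfy
one affine equation, giving `(q^3 - 1) * q * q^2` vectors. Otherwise coordinate 3 is zero and the
last three form any nonzero vector, giving `q^3 - 1` more. -/
theorem natCard_singular_ne_zero [Finite F] :
    Nat.card {x : Fin 7 → F // hexForm x = 0 ∧ x ≠ 0} =
      (Nat.card F ^ 3 - 1) * (Nat.card F ^ 3 + 1) := by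
  classical
  have h1 : Nat.card {x : Fin 7 → F // hexForm x = 0 ∧ (splitEquiv x).1.1 ≠ 0} =
      (Nat.card F ^ 3 - 1) * Nat.card F * Nat.card F ^ 2 := by
    have h0 : Nat.card {p : (Fin 3 → F) × F // p.1 ≠ 0 ∧ True} =
        (Nat.card F ^ 3 - 1) * Nat.card F :=
      natCard_subtype_prod (P := fun a : Fin 3 → F => a ≠ 0) (R := fun _ (_ : F) => True)
        natCard_ne_zero_fin_three fun _ _ => Nat.card_congr (Equiv.subtypeUnivEquiv fun _ => trivial)
    rw [← natCard_subtype_prod h0 fun p hp => natCard_dotProduct_eq hp.1 (p.2 ^ 2)]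
    exact Nat.card_congr (splitEquiv.subtypeEquiv fun x => by
      rw [hexForm_eq_zero_iff]
      tauto)
  have h2 : Nat.card {x : Fin 7 → F // hexForm x = 0 ∧ (splitEquiv x).1.1 = 0 ∧ x ≠ 0} =
      Nat.card F ^ 3 - 1 := by
    rw [← natCard_ne_zero_fin_three]
    refine Nat.card_congr
      { toFun := fun x => ⟨(splitEquiv x.1).2, fun h => x.2.2.2 ?_⟩
        invFun := fun b => ⟨splitEquiv.symm ((0, 0), b.1), ?_, ?_, fun h => b.2 ?_⟩
        left_inv := ?_
        right_inv := ?_ }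
    · apply splitEquiv.injective
      have h1 := hexForm_eq_zero_iff.1 x.2.1
      rw [x.2.2.1, zero_dotProduct] at h1
      have h2 : (splitEquiv x.1).1.2 = 0 := by simpa using h1.symm
      refine Prod.ext (Prod.ext (x.2.2.1.trans ?_) (h2.trans ?_)) (h.trans ?_)
      · ext i; fin_cases i <;> rfl
      · rfl
      · ext i; fin_cases i <;> rfl
    · simp [hexForm_eq_zero_iff]
    · simp
    · have := congrArg (fun x => (splitEquiv x).2) h
      simp only [Equiv.apply_symm_apply] at this
      rw [this]
      ext i; fin_cases i <;> rfl
    · intro x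
      apply Subtype.ext
      apply splitEquiv.injective
      have h1 := hexForm_eq_zero_iff.1 x.2.1
      rw [x.2.2.1, zero_dotProduct] at h1
      have h2 : (splitEquiv x.1).1.2 = 0 := by simpa using h1.symm
      simp only [Equiv.apply_symm_apply]
      exact Prod.ext (Prod.ext x.2.2.1.symm h2.symm) rfl
    · intro b
      simp
  have h3 : Nat.card {x : Fin 7 → F // hexForm x = 0 ∧ x ≠ 0} =
      Nat.card {x : Fin 7 → F // hexForm x = 0 ∧ (splitEquiv x).1.1 ≠ 0} +
      Nat.card {x : Fin 7 → F // hexForm x = 0 ∧ (splitEquiv x).1.1 = 0 ∧ x ≠ 0} := by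
    rw [← Nat.card_sum]
    refine Nat.card_congr ((Equiv.subtypeEquivRight fun x => ?_).trans (subtypeOrEquiv _ _ ?_))
    · constructor
      · rintro ⟨h1, h2⟩
        by_cases h : (splitEquiv x).1.1 = 0
        · exact Or.inr ⟨h1, h, h2⟩
        · exact Or.inl ⟨h1, h⟩
      · rintro (⟨h1, h2⟩ | ⟨h1, h2, h3⟩)
        · refine ⟨h1, ?_⟩
          rintro rfl
          apply h2
          ext i; fin_cases i <;> rfl
        · exact ⟨h1, h3⟩
    · rw [Pi.disjoint_iff]
      intro x
      rw [Prop.disjoint_iff]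
      tauto
  rw [h3, h1, h2]
  ring

/-- With `x` moved to `hexE₀` the polar condition reads `y 4 = 1`; singularity then determines `y 0`
and leaves five free coordinates. -/
theorem natCard_hexPolar_eq_one [Finite F] {x : Fin 7 → F} (hx : hexForm x = 0) (h0 : x ≠ 0) :
    Nat.card {y : Fin 7 → F // hexForm y = 0 ∧ hexPolar x y = 1} = Nat.card F ^ 5 := by
  obtain ⟨g, hg, hgx⟩ := exists_isHexAut_of_ne_zero hx h0
  have h1 : Nat.card {y : Fin 7 → F // hexForm y = 0 ∧ hexPolar x y = 1} =
      Nat.card {y : Fin 7 → F // hexForm y = 0 ∧ y 4 = 1} :=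
    Nat.card_congr (g.toEquiv.subtypeEquiv fun y => by
      rw [← hg.hexPolar_apply, hgx, ← hg.hexForm_apply y]
      simp [hexPolar, hexE₀])
  rw [h1]
  have h2 : Nat.card (Fin 5 → F) = Nat.card F ^ 5 := by simp [Nat.card_pi]
  rw [← h2]
  refine Nat.card_congr
    { toFun := fun y => ![y.1 1, y.1 2, y.1 3, y.1 5, y.1 6]
      invFun := fun z => ⟨![z 2 ^ 2 - z 0 * z 3 - z 1 * z 4, z 0, z 1, z 2, 1, z 3, z 4], ?_, rfl⟩
      left_inv := ?_
      right_inv := ?_ }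
  · simp [hexForm]
    ring
  · rintro ⟨y, hy, h4⟩
    apply Subtype.ext
    have : y 0 = y 3 ^ 2 - y 1 * y 5 - y 2 * y 6 := by
      unfold hexForm at hy
      rw [h4] at hy
      linear_combination hy
    ext i
    fin_cases i <;> simp [this, h4]
  · intro z
    ext i
    fin_cases i <;> rfl

/-- The hyperbolic pairs of singular vectors. -/
def IsHyperbolicPair (p : (Fin 7 → F) × (Fin 7 → F)) : Prop :=
  hexForm p.1 = 0 ∧ hexForm p.2 = 0 ∧ hexPolar p.1 p.2 = 1

theorem IsHyperbolicPair.ne_zero {p : (Fin 7 → F) × (Fin 7 → F)} (hp : IsHyperbolicPair p) :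
    p.1 ≠ 0 ∧ p.2 ≠ 0 := by
  constructor <;> intro h <;> have := hp.2.2 <;> rw [h] at this <;> simp [hexPolar] at this

theorem natCard_isHyperbolicPair [Finite F] :
    Nat.card {p : (Fin 7 → F) × (Fin 7 → F) // IsHyperbolicPair p} =
      (Nat.card F ^ 3 - 1) * (Nat.card F ^ 3 + 1) * Nat.card F ^ 5 := by
  rw [← natCard_subtype_prod natCard_singular_ne_zero
    fun x hx => natCard_hexPolar_eq_one hx.1 hx.2]
  refine Nat.card_congr (Equiv.subtypeEquivRight fun p => ?_)
  exact ⟨fun h => ⟨⟨h.1, h.ne_zero.1⟩, h.2⟩, fun h => ⟨h.1.1, h.2⟩⟩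

theorem hexPolar_embA_embB (a b : Fin 3 → F) : hexPolar (embA a) (embB b) = a ⬝ᵥ b := by
  simp [hexPolar, embA_apply, embB_apply, dotProduct, Fin.sum_univ_three]

theorem hexPolar_embB_embA (a b : Fin 3 → F) : hexPolar (embB a) (embA b) = a ⬝ᵥ b := by
  simp [hexPolar, embA_apply, embB_apply, dotProduct, Fin.sum_univ_three]

theorem hexPolar_embA_embA (a b : Fin 3 → F) : hexPolar (embA a) (embA b) = 0 := by
  simp [hexPolar, embA_apply]

theorem hexPolar_embB_embB (a b : Fin 3 → F) : hexPolar (embB a) (embB b) = 0 := by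
  simp [hexPolar, embB_apply]

/-- Both 3-spaces are totally singular, so the pair has one vector in each. The factor two records
which vector lies in which. -/
theorem natCard_covers_standardSubhexagon [Finite F] :
    Nat.card {p : (Fin 7 → F) × (Fin 7 → F) // IsHyperbolicPair p ∧
      Covers standardSubhexagon p.1 ∧ Covers standardSubhexagon p.2} =
      2 * ((Nat.card F ^ 3 - 1) * Nat.card F ^ 2) := by
  rw [← natCard_dotProduct_eq_one, two_mul, ← Nat.card_sum]
  have hA : ∀ a b : Fin 3 → F, a ⬝ᵥ b = 1 → IsHyperbolicPair (embA a, embB b) := fun a b h =>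
    ⟨hexForm_embA a, hexForm_embB b, (hexPolar_embA_embB a b).trans h⟩
  have hB : ∀ a b : Fin 3 → F, a ⬝ᵥ b = 1 → IsHyperbolicPair (embB a, embA b) := fun a b h =>
    ⟨hexForm_embB a, hexForm_embA b, (hexPolar_embB_embA a b).trans h⟩
  refine (Nat.card_congr (Equiv.ofBijective (Sum.elim
    (fun p => ⟨(embA p.1.1, embB p.1.2), hA _ _ p.2,
      (covers_standardSubhexagon (hA _ _ p.2).ne_zero.1).2 (Or.inl ⟨_, rfl⟩),
      (covers_standardSubhexagon (hA _ _ p.2).ne_zero.2).2 (Or.inr ⟨_, rfl⟩)⟩)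
    (fun p => ⟨(embB p.1.1, embA p.1.2), hB _ _ p.2,
      (covers_standardSubhexagon (hB _ _ p.2).ne_zero.1).2 (Or.inr ⟨_, rfl⟩),
      (covers_standardSubhexagon (hB _ _ p.2).ne_zero.2).2 (Or.inl ⟨_, rfl⟩)⟩))
    ⟨?_, ?_⟩)).symm
  · have hne : ∀ a b : Fin 3 → F, embA a = embB b → a = 0 := fun a b h =>
      (embA_add_embB_inj (show embA a + embB 0 = embA 0 + embB b by simp [h])).1
    rintro (⟨⟨a, b⟩, h⟩ | ⟨⟨a, b⟩, h⟩) (⟨⟨a', b'⟩, h'⟩ | ⟨⟨a', b'⟩, h'⟩) heq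
    all_goals
      have h1 := congrArg (fun p => p.1.1) heq
      have h2 := congrArg (fun p => p.1.2) heq
      simp only [Sum.elim_inl, Sum.elim_inr] at h1 h2
    · exact congrArg Sum.inl (Subtype.ext (Prod.ext (embA_injective h1) (embB_injective h2)))
    · rw [hne _ _ h1, zero_dotProduct] at h
      exact absurd h zero_ne_one
    · rw [hne _ _ h1.symm, zero_dotProduct] at h'
      exact absurd h' zero_ne_one
    · exact congrArg Sum.inr (Subtype.ext (Prod.ext (embB_injective h1) (embA_injective h2)))
  · rintro ⟨⟨x, y⟩, h, hx, hy⟩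
    have hxy : hexPolar x y = 1 := h.2.2
    rcases (covers_standardSubhexagon h.ne_zero.1).1 hx with ⟨a, rfl⟩ | ⟨a, rfl⟩ <;>
    rcases (covers_standardSubhexagon h.ne_zero.2).1 hy with ⟨b, rfl⟩ | ⟨b, rfl⟩
    · rw [hexPolar_embA_embA] at hxy
      exact absurd hxy zero_ne_one
    · exact ⟨Sum.inl ⟨(a, b), (hexPolar_embA_embB a b).symm.trans hxy⟩, rfl⟩
    · exact ⟨Sum.inr ⟨(a, b), (hexPolar_embB_embA a b).symm.trans hxy⟩, rfl⟩
    · rw [hexPolar_embB_embB] at hxy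
      exact absurd hxy zero_ne_one

theorem isSubhexagon_of_isIsomorphic [Finite F] {S : Subgeometry (dualSplitCayleyHexagon F)}
    (hS : S.toGeometry.IsIsomorphic (hexagonQOne F)) : S.IsSubhexagon :=
  hS.elim fun θ => ⟨_, _, isGeneralizedPolygon_hexagonQOne.of_iso θ.symm⟩

instance [Finite F] : Finite (Subgeometry (dualSplitCayleyHexagon F)) :=
  Finite.of_injective (fun S => (S.points, S.lines)) fun _ _ h =>
    Subgeometry.ext (congrArg Prod.fst h) (congrArg Prod.snd h)

/-- The number of hyperbolic pairs covered by a subhexagon. -/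
theorem natCard_covers [Finite F] {S : Subgeometry (dualSplitCayleyHexagon F)}
    (hS : S.toGeometry.IsIsomorphic (hexagonQOne F)) :
    Nat.card {p : (Fin 7 → F) × (Fin 7 → F) // IsHyperbolicPair p ∧ Covers S p.1 ∧ Covers S p.2} =
      2 * ((Nat.card F ^ 3 - 1) * Nat.card F ^ 2) := by
  obtain ⟨x, y, hx, hy, hxy, h1, h2⟩ := exists_covers hS
  obtain ⟨g, hg, hgx, hgy⟩ := exists_isHexAut_of_hexPolar_eq_one hx hy hxy
  have hmap := (isIsomorphic_and_covers_iff hg hgx hgy).1 ⟨hS, h1, h2⟩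
  rw [← natCard_covers_standardSubhexagon, ← hmap]
  refine Nat.card_congr ((g.toEquiv.prodCongr g.toEquiv).subtypeEquiv fun p => ?_)
  simp only [Equiv.prodCongr_apply, Prod.map_fst, Prod.map_snd, LinearEquiv.coe_toEquiv,
    IsHyperbolicPair, covers_map, hg.hexForm_apply, hg.hexPolar_apply]

/-- Double counting of the hyperbolic pairs covered by subhexagons. -/
theorem natCard_subhexagon_mul [Finite F] :
    Nat.card {S : Subgeometry (dualSplitCayleyHexagon F) //
      S.toGeometry.IsIsomorphic (hexagonQOne F)} * (2 * ((Nat.card F ^ 3 - 1) * Nat.card F ^ 2)) =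
      (Nat.card F ^ 3 - 1) * (Nat.card F ^ 3 + 1) * Nat.card F ^ 5 := by
  rw [← natCard_isHyperbolicPair]
  have key : ∀ p : {p : (Fin 7 → F) × (Fin 7 → F) // IsHyperbolicPair p},
      ∃ T : Subgeometry (dualSplitCayleyHexagon F), ∀ S : Subgeometry (dualSplitCayleyHexagon F),
        (S.toGeometry.IsIsomorphic (hexagonQOne F) ∧ Covers S p.1.1 ∧ Covers S p.1.2) ↔ S = T := by
    rintro ⟨p, hp⟩
    obtain ⟨g, hg, hgx, hgy⟩ := exists_isHexAut_of_hexPolar_eq_one hp.1 hp.2.1 hp.2.2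
    refine ⟨standardSubhexagon.map (hexIso g hg).symm, fun S => ?_⟩
    rw [isIsomorphic_and_covers_iff hg hgx hgy]
    constructor
    · intro h
      rw [← h, Subgeometry.map_symm_map]
    · rintro rfl
      exact Subgeometry.map_symm_map (hexIso g hg).symm _
  choose T hT using key
  -- Each pair is sent to the only subgeometry covering it; the fibers are the sets of covered
  -- pairs, all of the same size by `natCard_covers`.
  let f : {p : (Fin 7 → F) × (Fin 7 → F) // IsHyperbolicPair p} →
      {S : Subgeometry (dualSplitCayleyHexagon F) //
        S.toGeometry.IsIsomorphic (hexagonQOne F)} := fun p => ⟨T p, ((hT p _).2 rfl).1⟩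
  rw [← Nat.card_congr (Equiv.sigmaFiberEquiv f)]
  refine (natCard_sigma_const rfl fun S => ?_).symm
  rw [← natCard_covers S.2]
  refine Nat.card_congr
    { toFun := fun p => ⟨p.1.1, p.1.2, ?_⟩
      invFun := fun p => ⟨⟨p.1, p.2.1⟩, ?_⟩
      left_inv := fun _ => rfl
      right_inv := fun _ => rfl }
  · have : S.1 = T p.1 := congrArg Subtype.val p.2.symm
    exact ((hT p.1 S.1).2 this).2
  · exact Subtype.ext ((hT ⟨p.1, p.2.1⟩ S.1).1 ⟨S.2, p.2.2⟩).symm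

end Counting

end IncGeom

theorem mainTheorem6 (F : Type*) [Field F] [Fintype F] (q : ℕ) (hq : Fintype.card F = q) :
    (({S : IncGeom.PointLineGeometry.Subgeometry (IncGeom.dualSplitCayleyHexagon F) |
        S.IsSubhexagon ∧
          S.toGeometry.IsIsomorphic (IncGeom.hexagonQOne F)}.ncard : ℕ) : ℚ) =
      (q : ℚ) ^ 3 * (1 + (q : ℚ)) * ((q : ℚ) ^ 2 - (q : ℚ) + 1) / 2 := by
  have hset : {S : IncGeom.PointLineGeometry.Subgeometry (IncGeom.dualSplitCayleyHexagon F) |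
      S.IsSubhexagon ∧ S.toGeometry.IsIsomorphic (IncGeom.hexagonQOne F)} =
      {S | S.toGeometry.IsIsomorphic (IncGeom.hexagonQOne F)} :=
    Set.ext fun S => ⟨And.right, fun h => ⟨IncGeom.isSubhexagon_of_isIsomorphic h, h⟩⟩
  have hcount := IncGeom.natCard_subhexagon_mul (F := F)
  have hq1 : 1 < q := hq ▸ Fintype.one_lt_card
  rw [hset, ← Nat.card_coe_set_eq]
  rw [Nat.card_eq_fintype_card (α := F), hq] at hcount
  change Nat.card {S : IncGeom.PointLineGeometry.Subgeometry
    (IncGeom.dualSplitCayleyHexagon F) |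
    S.toGeometry.IsIsomorphic (IncGeom.hexagonQOne F)} * _ = _ at hcount
  generalize Nat.card {S : IncGeom.PointLineGeometry.Subgeometry
    (IncGeom.dualSplitCayleyHexagon F) | S.toGeometry.IsIsomorphic (IncGeom.hexagonQOne F)} = N
    at hcount ⊢
  have hq3 : 1 < q ^ 3 := Nat.one_lt_pow (by norm_num) hq1
  have h : ((q : ℚ) ^ 3 - 1) * (q : ℚ) ^ 2 ≠ 0 := by
    have h1 : (1 : ℚ) < (q : ℚ) ^ 3 := by exact_mod_cast hq3
    have h2 : (0 : ℚ) < q := by exact_mod_cast (by omega : 0 < q)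
    exact mul_ne_zero (by linarith) (by positivity)
  have hcast := congrArg (Nat.cast : ℕ → ℚ) hcount
  -- The difference `q ^ 3 - 1` is truncated in `ℕ`, so its cast needs `1 ≤ q ^ 3`.
  push_cast [Nat.cast_sub hq3.le] at hcast
  apply mul_right_cancel₀ h
  -- Uses `(1 + q)(q^2 - q + 1) = q^3 + 1`.
  linear_combination hcast / 2
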